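/- For $c\in\mathbb S^2$ (the unit sphere in $\mathbb R^3$) and $0<r<\pi$, the spherical disk of radius $r$ centered at $c$ is $\{u\in\mathbb S^2 : d_{\mathbb S^2}(u,c)\le r\}$, where $d_{\mathbb S^2}(a,b)$ is the angle between the vectors $a$ and $b$. A spherical uniform disk graph with radius $r$ is the intersection graph of a finite family of spherical disks of the same radius $r$ (two distinct vertices are adjacent if and only if their disks intersect). A layering of a graph $G$ is a partition $(V_i)_i$ of $V(G)$ into layers indexed by consecutive integers, possibly empty, such that the layers of adjacent vertices are equal or consecutive. A tree decomposition $\mathcal T=(T,\{X_t\}_{t\in V(T)})$ and a layering $(V_i)_i$ of $G$ witness layered tree-independence number $k$ if $\alpha(G[X_t\cap V_i])\le k$ for every bag $X_t$ and every layer $V_i$; the layered tree-independence number of $G$ is the least $k$ that is witnessed by some tree decomposition and some layering of $G$. We write $|\mathcal T|=|V(T)|$. **Theorem.** Let $G$ be a spherical uniform disk graph with radius $r$ on $n\ge 1$ vertices, given by $r$ and by the polar coordinates $(b,\theta)$ of the centers of its disks, where $b$ is the distance from a fixed pole $o\in\mathbb S^2$ and $\theta\in[0,2\pi)$ is the angle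 to a fixed polar axis, a half great circle from $o$ to its antipode $o^*$ (the points $o$ and $o^*$ of the axis get the angle $0$). On a real RAM (unit-cost registers and arrays of natural numbers with addition, subtraction and comparison, and of real numbers with field operations and comparison; no rounding) that can obtain $\inf_{x\in O}\theta(x)$ and $\sup_{x\in O}\theta(x)$ in one step for each given disk $O$, it is possible to compute, in $\mathcal O(n\log n)$ time, with a constant independent of $r$ and of the disks, a tree decomposition $\mathcal T$ of $G$ with $|\mathcal T|\le 2n$ and a layering of $G$ that witness layered tree-independence number $30$. Here $T$ is a path, and the output consists of the number of its nodes and, for each vertex $v$, the first and the last node of the subpath formed by the nodes whose bags contain $v$, and the index of the layer of $v$. In particular, every spherical uniform disk graph, with any radius $r\in(0,\pi)$, has layered tree-independence number at most $30$. -/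

import Mathlib

/-! ### Graphs: intersection graphs, tree decompositions, layerings -/

/-- The intersection graph of an indexed family of sets: two distinct indices are adjacent if and
only if the corresponding sets intersect. -/
def intersectionGraph {V X : Type*} (D : V → Set X) : SimpleGraph V where
  Adj u v := u ≠ v ∧ (D u ∩ D v).Nonempty
  symm := ⟨fun _ _ h => ⟨h.1.symm, by rw [Set.inter_comm]; exact h.2⟩⟩
  loopless := ⟨fun _ h => h.1 rfl⟩

/-- A tree decomposition of a (finite) graph `G`. The nodes of the tree are numbered. -/
structure TreeDecomposition {V : Type*} (G : SimpleGraph V) where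
  /-- the number `|𝒯|` of nodes of the tree -/
  size : ℕ
  tree : SimpleGraph (Fin size)
  isTree : tree.IsTree
  bag : Fin size → Set V
  exists_mem_bag : ∀ v, ∃ t, v ∈ bag t
  exists_edge_bag : ∀ u v, G.Adj u v → ∃ t, u ∈ bag t ∧ v ∈ bag t
  connected_nodes : ∀ v, (tree.induce {t | v ∈ bag t}).Connected

/-- A layering of `G`: an ordered partition of the vertices into layers, such that the layers
of adjacent vertices are equal or consecutive. It is given by the layer index of each vertex. -/
structure Layering {V : Type*} (G : SimpleGraph V) where
  idx : V → ℕ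
  adj_le : ∀ u v, G.Adj u v → idx u ≤ idx v + 1

/-- The `i`-th layer of a layering. -/
def Layering.layer {V : Type*} {G : SimpleGraph V} (L : Layering G) (i : ℕ) : Set V :=
  {v | L.idx v = i}

/-- The tree decomposition `𝒯` and the layering `L` witness layered tree-independence number `k`:
each intersection of a bag and a layer induces a subgraph of independence number at most `k`. -/
def TreeDecomposition.Witnesses {V : Type*} {G : SimpleGraph V} (𝒯 : TreeDecomposition G)
    (L : Layering G) (k : ℕ) : Prop :=
  ∀ t i, (G.induce (𝒯.bag t ∩ L.layer i)).indepNum ≤ k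

/-- The layered independence number of a tree decomposition. -/
noncomputable def TreeDecomposition.layeredIndependenceNumber {V : Type*} {G : SimpleGraph V}
    (𝒯 : TreeDecomposition G) : ℕ :=
  sInf {k | ∃ L : Layering G, 𝒯.Witnesses L k}

/-- The layered tree-independence number of a (finite) graph. -/
noncomputable def layeredTreeIndependenceNumber {V : Type*} (G : SimpleGraph V) : ℕ :=
  sInf (Set.range fun 𝒯 : TreeDecomposition G => 𝒯.layeredIndependenceNumber)

/-! ### Spherical uniform disk graphs and polar coordinates -/

/-- The unit sphere in three-dimensional Euclidean space. -/
abbrev UnitSphere : Type := Metric.sphere (0 : EuclideanSpace ℝ (Fin 3)) 1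

/-- The spherical distance of two points of the unit sphere, the angle between them. -/
noncomputable def sphericalDist (a b : UnitSphere) : ℝ :=
  InnerProductGeometry.angle (a : EuclideanSpace ℝ (Fin 3)) (b : EuclideanSpace ℝ (Fin 3))

/-- The (closed) spherical disk, or spherical cap, of radius `r` centered at `c`. -/
def sphericalDisk (c : UnitSphere) (r : ℝ) : Set UnitSphere := {u | sphericalDist u c ≤ r}

/-- `G` is a spherical uniform disk graph with radius `r`. -/
def IsSphericalUniformDiskGraph {V : Type*} (G : SimpleGraph V) (r : ℝ) : Prop :=
  0 < r ∧ r < Real.pi ∧ ∃ c : V → UnitSphere, G = intersectionGraph fun v => sphericalDisk (c v) r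

/-- The point with polar coordinates `(b, θ)`: the pole is `(0, 0, 1)`, the polar axis is the half
great circle of the points `(sin b, 0, cos b)` with `0 ≤ b ≤ π`. -/
noncomputable def polarPoint (b θ : ℝ) : UnitSphere :=
  ⟨!₂[Real.sin b * Real.cos θ, Real.sin b * Real.sin θ, Real.cos b], by
    rw [mem_sphere_zero_iff_norm, EuclideanSpace.norm_eq, Real.sqrt_eq_one]
    simp only [Fin.sum_univ_three, Real.norm_eq_abs, sq_abs]
    simp
    nlinarith [Real.sin_sq_add_cos_sq b, Real.sin_sq_add_cos_sq θ]⟩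

/-- The polar angle of a point, in `[0, 2π)`. The pole and its antipode, the end points of the
polar axis, are given the angle `0` of the polar axis. -/
noncomputable def polarAngle (x : UnitSphere) : ℝ :=
  toIcoMod Real.two_pi_pos 0 (Complex.arg ⟨x.1 0, x.1 1⟩)

/-- An instance of the computational problem: `n` spherical disks of common radius `r`, given by
the polar coordinates of their centers. -/
structure DiskInstance (n : ℕ) where
  r : ℝ
  r_pos : 0 < r
  r_lt_pi : r < Real.pi
  b : Fin n → ℝ
  b_mem : ∀ v, b v ∈ Set.Icc 0 Real.pi
  θ : Fin n → ℝ
  θ_mem : ∀ v, θ v ∈ Set.Ico 0 (2 * Real.pi)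

namespace DiskInstance

variable {n : ℕ} (I : DiskInstance n)

/-- The `v`-th disk of the instance. -/
noncomputable def disk (v : Fin n) : Set UnitSphere := sphericalDisk (polarPoint (I.b v) (I.θ v)) I.r

/-- The spherical uniform disk graph of the instance. -/
noncomputable def graph : SimpleGraph (Fin n) := intersectionGraph I.disk

/-- The infimum of the polar angles of the points of the `i`-th disk. -/
noncomputable def angleInf (i : ℕ) : ℝ :=
  if h : i < n then sInf (polarAngle '' I.disk ⟨i, h⟩) else 0

/-- The supremum of the polar angles of the points of the `i`-th disk. -/
noncomputable def angleSup (i : ℕ) : ℝ :=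
  if h : i < n then sSup (polarAngle '' I.disk ⟨i, h⟩) else 0

end DiskInstance

/-! ### The machine model: a real RAM

A machine has finitely many registers for natural numbers, finitely many registers for real
numbers, and finitely many unbounded arrays of either kind (a program mentions only finitely many
of them). Natural numbers can be added, subtracted, compared and used as array indices. Real
numbers can be added, subtracted, multiplied, divided and compared; a real number cannot be rounded
or otherwise turned into a natural number. Each instruction and each test costs one step. -/

namespace RealRAM

/-- The contents of the memory. -/
structure State where
  /-- registers for natural numbers -/
  nat : ℕ → ℕ
  /-- registers for real numbers -/
  real : ℕ → ℝ
  /-- `natArr a i` is the entry with index `i` of the `a`-th array of natural numbers -/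
  natArr : ℕ → ℕ → ℕ
  /-- `realArr a i` is the entry with index `i` of the `a`-th array of real numbers -/
  realArr : ℕ → ℕ → ℝ

/-- Elementary instructions. The letter `d` is the number of the target register, `i` and `j` are
the numbers of argument registers, and `a` is the number of an array. -/
inductive Instr where
  | natConst (d k : ℕ)
  | natCopy (d i : ℕ)
  | natAdd (d i j : ℕ)
  | natSub (d i j : ℕ)
  | natLoad (d a i : ℕ)
  | natStore (a i j : ℕ)
  | realConst (d : ℕ) (q : ℚ)
  | realCopy (d i : ℕ)
  | realAdd (d i j : ℕ)
  | realSub (d i j : ℕ)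
  | realMul (d i j : ℕ)
  | realDiv (d i j : ℕ)
  | realLoad (d a i : ℕ)
  | realStore (a i j : ℕ)
  /-- query the first oracle at the natural number in register `i` -/
  | askInf (d i : ℕ)
  /-- query the second oracle at the natural number in register `i` -/
  | askSup (d i : ℕ)

namespace State

variable (s : State)

def setNat (d x : ℕ) : State := { s with nat := Function.update s.nat d x }

noncomputable def setReal (d : ℕ) (x : ℝ) : State := { s with real := Function.update s.real d x }

def setNatArr (a i x : ℕ) : State :=
  { s with natArr := Function.update s.natArr a (Function.update (s.natArr a) i x) }

noncomputable def setRealArr (a i : ℕ) (x : ℝ) : State :=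
  { s with realArr := Function.update s.realArr a (Function.update (s.realArr a) i x) }

end State

/-- The effect of an elementary instruction, for two given oracles. -/
noncomputable def Instr.step (inf sup : ℕ → ℝ) : Instr → State → State
  | natConst d k, s => s.setNat d k
  | natCopy d i, s => s.setNat d (s.nat i)
  | natAdd d i j, s => s.setNat d (s.nat i + s.nat j)
  | natSub d i j, s => s.setNat d (s.nat i - s.nat j)
  | natLoad d a i, s => s.setNat d (s.natArr a (s.nat i))
  | natStore a i j, s => s.setNatArr a (s.nat i) (s.nat j)
  | realConst d q, s => s.setReal d (q : ℝ)
  | realCopy d i, s => s.setReal d (s.real i)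
  | realAdd d i j, s => s.setReal d (s.real i + s.real j)
  | realSub d i j, s => s.setReal d (s.real i - s.real j)
  | realMul d i j, s => s.setReal d (s.real i * s.real j)
  | realDiv d i j, s => s.setReal d (s.real i / s.real j)
  | realLoad d a i, s => s.setReal d (s.realArr a (s.nat i))
  | realStore a i j, s => s.setRealArr a (s.nat i) (s.real j)
  | askInf d i, s => s.setReal d (inf (s.nat i))
  | askSup d i, s => s.setReal d (sup (s.nat i))

/-- Tests: comparisons of two registers of the same kind. -/
inductive Test where
  | natLt (i j : ℕ)
  | natLe (i j : ℕ)
  | realLt (i j : ℕ)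
  | realLe (i j : ℕ)

/-- The test succeeds in the given state. -/
def Test.Holds : Test → State → Prop
  | natLt i j, s => s.nat i < s.nat j
  | natLe i j, s => s.nat i ≤ s.nat j
  | realLt i j, s => s.real i < s.real j
  | realLe i j, s => s.real i ≤ s.real j

/-- Programs. -/
inductive Prog where
  | skip
  | instr (c : Instr)
  | seq (p q : Prog)
  | ite (b : Test) (p q : Prog)
  | while (b : Test) (p : Prog)

/-- `Exec inf sup p s t s'` says that the program `p`, with the two given oracles and started in
state `s`, halts in state `s'` after exactly `t` steps. -/
inductive Exec (inf sup : ℕ → ℝ) : Prog → State → ℕ → State → Prop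
  | skip (s : State) : Exec inf sup .skip s 0 s
  | instr (c : Instr) (s : State) : Exec inf sup (.instr c) s 1 (c.step inf sup s)
  | seq {p q : Prog} {s s₁ s₂ : State} {t₁ t₂ : ℕ} :
      Exec inf sup p s t₁ s₁ → Exec inf sup q s₁ t₂ s₂ → Exec inf sup (.seq p q) s (t₁ + t₂) s₂
  | iteTrue {b : Test} {p q : Prog} {s s₁ : State} {t : ℕ} :
      b.Holds s → Exec inf sup p s t s₁ → Exec inf sup (.ite b p q) s (t + 1) s₁
  | iteFalse {b : Test} {p q : Prog} {s s₁ : State} {t : ℕ} :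
      ¬ b.Holds s → Exec inf sup q s t s₁ → Exec inf sup (.ite b p q) s (t + 1) s₁
  | whileTrue {b : Test} {p : Prog} {s s₁ s₂ : State} {t₁ t₂ : ℕ} :
      b.Holds s → Exec inf sup p s t₁ s₁ → Exec inf sup (.while b p) s₁ t₂ s₂ →
      Exec inf sup (.while b p) s (t₁ + t₂ + 1) s₂
  | whileFalse {b : Test} {p : Prog} {s : State} :
      ¬ b.Holds s → Exec inf sup (.while b p) s 1 s

/-- The machine is deterministic: the result and the number of steps are unique. -/
theorem Exec.deterministic {inf sup : ℕ → ℝ} {p : Prog} {s s₁ s₂ : State} {t₁ t₂ : ℕ}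
    (h₁ : Exec inf sup p s t₁ s₁) (h₂ : Exec inf sup p s t₂ s₂) : t₁ = t₂ ∧ s₁ = s₂ := by
  induction h₁ generalizing t₂ s₂ with
  | skip s => cases h₂; exact ⟨rfl, rfl⟩
  | instr c s => cases h₂; exact ⟨rfl, rfl⟩
  | seq _ _ ih₁ ih₂ =>
    cases h₂ with
    | seq k₁ k₂ =>
      obtain ⟨rfl, rfl⟩ := ih₁ k₁
      obtain ⟨rfl, rfl⟩ := ih₂ k₂
      exact ⟨rfl, rfl⟩
  | iteTrue hb _ ih =>
    cases h₂ with
    | iteTrue _ k => obtain ⟨rfl, rfl⟩ := ih k; exact ⟨rfl, rfl⟩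
    | iteFalse hb' _ => exact absurd hb hb'
  | iteFalse hb _ ih =>
    cases h₂ with
    | iteTrue hb' _ => exact absurd hb' hb
    | iteFalse _ k => obtain ⟨rfl, rfl⟩ := ih k; exact ⟨rfl, rfl⟩
  | whileTrue hb _ _ ih₁ ih₂ =>
    cases h₂ with
    | whileTrue _ k₁ k₂ =>
      obtain ⟨rfl, rfl⟩ := ih₁ k₁
      obtain ⟨rfl, rfl⟩ := ih₂ k₂
      exact ⟨rfl, rfl⟩
    | whileFalse hb' => exact absurd hb hb'
  | whileFalse hb =>
    cases h₂ with
    | whileTrue hb' _ _ => exact absurd hb' hb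
    | whileFalse _ => exact ⟨rfl, rfl⟩

end RealRAM

/-! ### Input and output of the algorithm -/

/-- The initial memory: natural register `0` holds `n`, real register `0` holds the radius, the
real arrays `0` and `1` hold the polar coordinates `b` and `θ` of the centers, all else is `0`. -/
noncomputable def DiskInstance.initState {n : ℕ} (I : DiskInstance n) : RealRAM.State where
  nat := fun k => if k = 0 then n else 0
  real := fun k => if k = 0 then I.r else 0
  natArr := fun _ _ => 0
  realArr := fun a i =>
    if h : i < n then (if a = 0 then I.b ⟨i, h⟩ else if a = 1 then I.θ ⟨i, h⟩ else 0) else 0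

/-- The program `P`, run on the instance `I`, halts in state `s` after `t` steps. The two oracles
return, in one step, the infimum and the supremum of the polar angle on a disk of the instance. -/
def DiskInstance.Runs {n : ℕ} (I : DiskInstance n) (P : RealRAM.Prog) (t : ℕ)
    (s : RealRAM.State) : Prop :=
  RealRAM.Exec I.angleInf I.angleSup P I.initState t s

/-- The final memory `s` represents the tree decomposition `𝒯` and the layering `L`: the tree is
the path whose number of nodes is in natural register `1`, a vertex `v` lies exactly in the bags of
the nodes from `natArr 0 v` to `natArr 1 v`, and its layer has the index `natArr 2 v`. -/
def RealRAM.State.Represents {n : ℕ} {G : SimpleGraph (Fin n)} (s : RealRAM.State)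
    (𝒯 : TreeDecomposition G) (L : Layering G) : Prop :=
  𝒯.size = s.nat 1 ∧
  𝒯.tree = SimpleGraph.pathGraph 𝒯.size ∧
  (∀ t v, v ∈ 𝒯.bag t ↔ s.natArr 0 v ≤ (t : ℕ) ∧ (t : ℕ) ≤ s.natArr 1 v) ∧
  ∀ v : Fin n, L.idx v = s.natArr 2 v

/-!
The algorithm is a sweep in each of the two polar coordinates.

*Layers.* Adjacent disks have centers whose colatitudes `b` differ by at most `2r`. The centers are
sorted by colatitude and partitioned greedily into zones of width `2r`, each starting at the first
center beyond the previous zone (`ZoneInv`). This yields a layering without any rounding of reals,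
and with at most `n` layers however small `r` is.

*Bags.* Each disk has the interval from the infimum to the supremum of its polar angles, and
intersecting disks have intersecting intervals. The `2n` endpoints are sorted, ties being broken in
favour of the lower endpoints. The nodes of the path are the positions in this list, and a vertex
lies in the bags between the positions of its two endpoints (`pathDecomposition`). All intervals of
the vertices in one bag contain a common angle `α`.

*Independence.* A disk whose interval contains `α` meets the polar axis or the meridian at the angle
`α`: off the axis the polar angle is continuous, and a disk is connected and compact
(`mem_image_polarAngle`). If moreover the center lies in a given zone of width `2r`, it has distance
at most `2r` from one of two fixed points of that meridian
(`sphericalDist_le_of_mem_image_polarAngle`). Around each of these points there are six sectors of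
angle `π / 3`, and two points of one sector at distance at most `2r` from its apex have distance at
most `2r` from each other (`sphericalDist_le_of_sector_eq`), so that their disks share the midpoint.
Hence an independent set in the intersection of a bag and a layer has at most `2 · 2 · 6 = 24`
elements (`DiskInstance.indepNum_induce_le`).

*Running time.* Everything but sorting is linear. Sorting is a bottom-up merge sort
(`RealRAM.wp_sortProg`), verified with a program logic whose loop rule carries the time as a credit
(`RealRAM.Wp.while_credit`). The order of keys, with ties broken by index, is strict, so the sorted
list is described by ranks (`keyRank`): the item `x` stands at the position that equals the number
of its predecessors. In a merge the rank of an item is the sum of its ranks in the two blocks.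
-/

/-! ### Polar coordinates around an arbitrary point of the sphere -/

theorem UnitSphere.sum_sq (u : UnitSphere) : u.1 0 ^ 2 + u.1 1 ^ 2 + u.1 2 ^ 2 = 1 := by
  have h := u.2
  rw [mem_sphere_zero_iff_norm, EuclideanSpace.norm_eq, Real.sqrt_eq_one] at h
  simpa [Fin.sum_univ_three] using h

theorem UnitSphere.ext_coord {u v : UnitSphere} (h0 : u.1 0 = v.1 0) (h1 : u.1 1 = v.1 1)
    (h2 : u.1 2 = v.1 2) : u = v := by
  ext i
  fin_cases i <;> assumption

theorem cos_sphericalDist (u v : UnitSphere) :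
    Real.cos (sphericalDist u v) = u.1 0 * v.1 0 + u.1 1 * v.1 1 + u.1 2 * v.1 2 := by
  have hu : ‖u.1‖ = 1 := mem_sphere_zero_iff_norm.1 u.2
  have hv : ‖v.1‖ = 1 := mem_sphere_zero_iff_norm.1 v.2
  rw [sphericalDist, InnerProductGeometry.cos_angle, hu, hv]
  simp [PiLp.inner_apply, Fin.sum_univ_three]
  ring

theorem sphericalDist_nonneg (u v : UnitSphere) : 0 ≤ sphericalDist u v :=
  InnerProductGeometry.angle_nonneg _ _

theorem sphericalDist_le_pi (u v : UnitSphere) : sphericalDist u v ≤ Real.pi :=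
  InnerProductGeometry.angle_le_pi _ _

theorem sphericalDist_comm (u v : UnitSphere) : sphericalDist u v = sphericalDist v u :=
  InnerProductGeometry.angle_comm _ _

theorem sphericalDist_triangle (u v w : UnitSphere) :
    sphericalDist u w ≤ sphericalDist u v + sphericalDist v w :=
  InnerProductGeometry.angle_le_angle_add_angle _ _ _

theorem sphericalDist_le_of_cos_le {u v : UnitSphere} {R : ℝ} (h0 : 0 ≤ R)
    (h : Real.cos R ≤ Real.cos (sphericalDist u v)) : sphericalDist u v ≤ R := by
  by_contra! hlt
  exact absurd (Real.cos_lt_cos_of_nonneg_of_le_pi h0 (sphericalDist_le_pi u v) hlt) (not_lt.2 h)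

theorem sphericalDist_eq_of_cos_eq {u v : UnitSphere} {R : ℝ} (h0 : 0 ≤ R) (hR : R ≤ Real.pi)
    (h : Real.cos (sphericalDist u v) = Real.cos R) : sphericalDist u v = R :=
  Real.injOn_cos ⟨sphericalDist_nonneg u v, sphericalDist_le_pi u v⟩ ⟨h0, hR⟩ h

@[simp] theorem polarPoint_zero (b θ : ℝ) :
    (polarPoint b θ).1 0 = Real.sin b * Real.cos θ := rfl

@[simp] theorem polarPoint_one (b θ : ℝ) :
    (polarPoint b θ).1 1 = Real.sin b * Real.sin θ := rfl

@[simp] theorem polarPoint_two (b θ : ℝ) : (polarPoint b θ).1 2 = Real.cos b := rfl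

/-- The spherical distance of two points on a common meridian. -/
theorem sphericalDist_polarPoint_same_angle {b b' : ℝ} (hb : b ∈ Set.Icc 0 Real.pi)
    (hb' : b' ∈ Set.Icc 0 Real.pi) (θ : ℝ) :
    sphericalDist (polarPoint b θ) (polarPoint b' θ) = |b - b'| := by
  apply sphericalDist_eq_of_cos_eq (abs_nonneg _)
  · rw [abs_le]
    constructor <;> linarith [hb.1, hb.2, hb'.1, hb'.2]
  · rw [cos_sphericalDist, Real.cos_abs, Real.cos_sub]
    simp only [polarPoint_zero, polarPoint_one, polarPoint_two]
    linear_combination (Real.sin b * Real.sin b') * Real.sin_sq_add_cos_sq θ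

/-- The colatitude `b` is the distance from the pole, hence it is `1`-Lipschitz. -/
theorem abs_sub_le_sphericalDist {b b' : ℝ} (hb : b ∈ Set.Icc 0 Real.pi)
    (hb' : b' ∈ Set.Icc 0 Real.pi) (θ θ' : ℝ) :
    |b - b'| ≤ sphericalDist (polarPoint b θ) (polarPoint b' θ') := by
  have key : ∀ {b : ℝ}, b ∈ Set.Icc 0 Real.pi → ∀ θ,
      sphericalDist (polarPoint b θ) (polarPoint 0 0) = b := fun {b} hb θ => by
    apply sphericalDist_eq_of_cos_eq hb.1 hb.2
    simp [cos_sphericalDist]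
  have h1 := sphericalDist_triangle (polarPoint b θ) (polarPoint b' θ') (polarPoint 0 0)
  have h2 := sphericalDist_triangle (polarPoint b' θ') (polarPoint b θ) (polarPoint 0 0)
  rw [key hb, key hb'] at h1 h2
  rw [sphericalDist_comm (polarPoint b' θ')] at h2
  rw [abs_le]
  constructor <;> linarith

theorem cos_polarAngle (u : UnitSphere) :
    Real.cos (polarAngle u) = Real.cos (Complex.arg ⟨u.1 0, u.1 1⟩) := by
  rw [polarAngle, toIcoMod, zsmul_eq_mul, Real.cos_sub_int_mul_two_pi]

theorem sin_polarAngle (u : UnitSphere) :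
    Real.sin (polarAngle u) = Real.sin (Complex.arg ⟨u.1 0, u.1 1⟩) := by
  rw [polarAngle, toIcoMod, zsmul_eq_mul, Real.sin_sub_int_mul_two_pi]

theorem polarAngle_mem (u : UnitSphere) : polarAngle u ∈ Set.Ico 0 (2 * Real.pi) := by
  simpa [polarAngle] using toIcoMod_mem_Ico Real.two_pi_pos 0 (Complex.arg ⟨u.1 0, u.1 1⟩)

/-- Every point of the sphere is determined by its polar coordinates. -/
theorem polarPoint_arccos_polarAngle (u : UnitSphere) :
    polarPoint (Real.arccos (u.1 2)) (polarAngle u) = u := by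
  have hs := u.sum_sq
  have hn : ‖(⟨u.1 0, u.1 1⟩ : ℂ)‖ = Real.sin (Real.arccos (u.1 2)) := by
    rw [Real.sin_arccos, Complex.norm_def, Complex.normSq_mk]
    congr 1
    linarith
  apply UnitSphere.ext_coord
  · rw [polarPoint_zero, cos_polarAngle, ← hn, Complex.norm_mul_cos_arg]
  · rw [polarPoint_one, sin_polarAngle, ← hn, Complex.norm_mul_sin_arg]
  · rw [polarPoint_two, Real.cos_arccos] <;> nlinarith [sq_nonneg (u.1 0), sq_nonneg (u.1 1)]

/-- The point reached from `polarPoint b θ` after walking the distance `a` on a great circle, in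
the direction at angle `φ` from the meridian. -/
noncomputable def geodesicPoint (b θ a φ : ℝ) : UnitSphere :=
  ⟨!₂[Real.cos a * (Real.sin b * Real.cos θ) + Real.sin a * (Real.cos φ * (Real.cos b * Real.cos θ)
        - Real.sin φ * Real.sin θ),
      Real.cos a * (Real.sin b * Real.sin θ) + Real.sin a * (Real.cos φ * (Real.cos b * Real.sin θ)
        + Real.sin φ * Real.cos θ),
      Real.cos a * Real.cos b - Real.sin a * (Real.cos φ * Real.sin b)], by
    rw [mem_sphere_zero_iff_norm, EuclideanSpace.norm_eq, Real.sqrt_eq_one]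
    simp only [Fin.sum_univ_three, Real.norm_eq_abs, sq_abs]
    simp only [Matrix.cons_val]
    have ha := Real.cos_sq' a
    have hb := Real.cos_sq' b
    have hφ := Real.cos_sq' φ
    have hθ := Real.cos_sq' θ
    ring_nf
    simp only [ha, hb, hφ, hθ]
    ring⟩

/-- The direction in which `u` is seen from `polarPoint b θ`, as an angle in `(-π, π]` from the
meridian (`0` if `u` is `polarPoint b θ` or its antipode). -/
noncomputable def bearing (b θ : ℝ) (u : UnitSphere) : ℝ :=
  Complex.arg ⟨u.1 0 * (Real.cos b * Real.cos θ) + u.1 1 * (Real.cos b * Real.sin θ)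
    - u.1 2 * Real.sin b, u.1 1 * Real.cos θ - u.1 0 * Real.sin θ⟩

theorem geodesicPoint_bearing (b θ : ℝ) (u : UnitSphere) :
    geodesicPoint b θ (sphericalDist u (polarPoint b θ)) (bearing b θ u) = u := by
  set a := sphericalDist u (polarPoint b θ) with ha
  have hs := u.sum_sq
  have hc : Real.cos a = u.1 0 * (Real.sin b * Real.cos θ) + u.1 1 * (Real.sin b * Real.sin θ)
      + u.1 2 * Real.cos b := cos_sphericalDist u (polarPoint b θ)
  have hb := Real.sin_sq_add_cos_sq b
  have hθ := Real.sin_sq_add_cos_sq θ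
  have hn : ‖(⟨u.1 0 * (Real.cos b * Real.cos θ) + u.1 1 * (Real.cos b * Real.sin θ)
      - u.1 2 * Real.sin b, u.1 1 * Real.cos θ - u.1 0 * Real.sin θ⟩ : ℂ)‖ = Real.sin a := by
    rw [Complex.norm_def, Complex.normSq_mk,
      Real.sin_eq_sqrt_one_sub_cos_sq (sphericalDist_nonneg _ _) (sphericalDist_le_pi _ _), ← ha,
      hc]
    congr 1
    linear_combination ((u.1 0 * Real.cos θ + u.1 1 * Real.sin θ) ^ 2 + u.1 2 ^ 2) * hb
      + (u.1 0 ^ 2 + u.1 1 ^ 2) * hθ + hs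
  have h1 : Real.sin a * Real.cos (bearing b θ u) = u.1 0 * (Real.cos b * Real.cos θ)
      + u.1 1 * (Real.cos b * Real.sin θ) - u.1 2 * Real.sin b := by
    rw [← hn]; exact Complex.norm_mul_cos_arg _
  have h2 : Real.sin a * Real.sin (bearing b θ u) = u.1 1 * Real.cos θ - u.1 0 * Real.sin θ := by
    rw [← hn]; exact Complex.norm_mul_sin_arg _
  apply UnitSphere.ext_coord
  · change Real.cos a * (Real.sin b * Real.cos θ) + Real.sin a * (Real.cos (bearing b θ u) *
      (Real.cos b * Real.cos θ) - Real.sin (bearing b θ u) * Real.sin θ) = u.1 0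
    linear_combination (Real.sin b * Real.cos θ) * hc + (Real.cos b * Real.cos θ) * h1
      - Real.sin θ * h2 + (u.1 0 * Real.cos θ ^ 2 + u.1 1 * Real.cos θ * Real.sin θ) * hb
      + u.1 0 * hθ
  · change Real.cos a * (Real.sin b * Real.sin θ) + Real.sin a * (Real.cos (bearing b θ u) *
      (Real.cos b * Real.sin θ) + Real.sin (bearing b θ u) * Real.cos θ) = u.1 1
    linear_combination (Real.sin b * Real.sin θ) * hc + (Real.cos b * Real.sin θ) * h1
      + Real.cos θ * h2 + (u.1 1 * Real.sin θ ^ 2 + u.1 0 * Real.cos θ * Real.sin θ) * hb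
      + u.1 1 * hθ
  · change Real.cos a * Real.cos b - Real.sin a * (Real.cos (bearing b θ u) * Real.sin b) = u.1 2
    linear_combination Real.cos b * hc - Real.sin b * h1 + u.1 2 * hb

/-- The spherical law of cosines. -/
theorem cos_sphericalDist_geodesicPoint (b θ a φ a' φ' : ℝ) :
    Real.cos (sphericalDist (geodesicPoint b θ a φ) (geodesicPoint b θ a' φ')) =
      Real.cos a * Real.cos a' + Real.sin a * Real.sin a' * Real.cos (φ - φ') := by
  rw [cos_sphericalDist, Real.cos_sub]
  simp only [geodesicPoint, Matrix.cons_val]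
  have hb := Real.cos_sq' b
  have hθ := Real.cos_sq' θ
  ring_nf
  simp only [hb, hθ]
  ring

theorem sphericalDist_geodesicPoint_self (b θ φ : ℝ) {a : ℝ} (ha : a ∈ Set.Icc 0 Real.pi) :
    sphericalDist (geodesicPoint b θ a φ) (polarPoint b θ) = a := by
  apply sphericalDist_eq_of_cos_eq ha.1 ha.2
  rw [cos_sphericalDist]
  simp only [geodesicPoint, polarPoint, Matrix.cons_val]
  have hb := Real.cos_sq' b
  have hθ := Real.cos_sq' θ
  ring_nf
  simp only [hb, hθ]
  ring

/-! ### Intersecting disks -/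

/-- Two disks of radius `r` intersect if and only if their centers have distance at most `2r`; if
they do, the midpoint of the centers lies in both. -/
theorem sphericalDisk_inter_nonempty_iff (b θ : ℝ) (u : UnitSphere) {r : ℝ} (hr : r < Real.pi) :
    (sphericalDisk u r ∩ sphericalDisk (polarPoint b θ) r).Nonempty ↔
      sphericalDist u (polarPoint b θ) ≤ 2 * r := by
  constructor
  · rintro ⟨w, hw, hw'⟩
    have := sphericalDist_triangle u w (polarPoint b θ)
    rw [sphericalDist_comm u w] at this
    simp only [sphericalDisk, Set.mem_ofPred_eq] at hw hw'
    linarith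
  · intro h
    set a := sphericalDist u (polarPoint b θ) with ha
    have h0 : 0 ≤ a := sphericalDist_nonneg _ _
    have hpi : a ≤ Real.pi := sphericalDist_le_pi _ _
    refine ⟨geodesicPoint b θ (a / 2) (bearing b θ u), ?_, ?_⟩
    · change sphericalDist _ _ ≤ r
      rw [show sphericalDist (geodesicPoint b θ (a / 2) (bearing b θ u)) u = a / 2 from ?_]
      · linarith
      apply sphericalDist_eq_of_cos_eq (by linarith) (by linarith)
      nth_rw 2 [← geodesicPoint_bearing b θ u]
      rw [cos_sphericalDist_geodesicPoint, sub_self, Real.cos_zero, mul_one, ← ha,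
        ← Real.cos_sub, ← Real.cos_neg]
      congr 1
      ring
    · change sphericalDist _ _ ≤ r
      rw [sphericalDist_geodesicPoint_self b θ _ ⟨by linarith, by linarith⟩]
      linarith

/-! ### Packing: six sectors -/

/-- By the spherical law of cosines, this says that in a spherical triangle with an angle of `π / 3`
the opposite side is not longer than the longer one, `a'`, of the two other sides. -/
theorem cos_le_of_angle_le_third {a a' : ℝ} (h0 : 0 ≤ a) (h : a ≤ a') (hpi : a' ≤ Real.pi) :
    Real.cos a' ≤ Real.cos a * Real.cos a' + Real.sin a * Real.sin a' * (1 / 2) := by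
  obtain ⟨x, rfl⟩ : ∃ x, a = 2 * x := ⟨a / 2, by ring⟩
  obtain ⟨y, rfl⟩ : ∃ y, a' = 2 * y := ⟨a' / 2, by ring⟩
  have hsx : 0 ≤ Real.sin x := Real.sin_nonneg_of_nonneg_of_le_pi (by linarith) (by linarith)
  have hsy : 0 ≤ Real.sin y := Real.sin_nonneg_of_nonneg_of_le_pi (by linarith) (by linarith)
  have hcx : 0 ≤ Real.cos x :=
    Real.cos_nonneg_of_neg_pi_div_two_le_of_le (by linarith) (by linarith)
  have hcy : 0 ≤ Real.cos y :=
    Real.cos_nonneg_of_neg_pi_div_two_le_of_le (by linarith) (by linarith)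
  have hd : 0 ≤ Real.sin (y - x) := Real.sin_nonneg_of_nonneg_of_le_pi (by linarith) (by linarith)
  rw [Real.sin_sub] at hd
  have e1 := Real.sin_sq_add_cos_sq x
  have e2 := Real.sin_sq_add_cos_sq y
  -- the difference is `2 sin x (sin (y - x) cos y + sin x sin² y)`
  have key : Real.cos (2 * x) * Real.cos (2 * y) + Real.sin (2 * x) * Real.sin (2 * y) * (1 / 2)
      - Real.cos (2 * y) = 2 * Real.sin x * ((Real.sin y * Real.cos x - Real.cos y * Real.sin x)
        * Real.cos y + Real.sin x * Real.sin y ^ 2) := by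
    rw [Real.sin_two_mul, Real.sin_two_mul, Real.cos_two_mul x, Real.cos_two_mul y]
    linear_combination (2 - 4 * Real.cos y ^ 2) * (-e1) - 2 * Real.sin x ^ 2 * e2
  have : 0 ≤ 2 * Real.sin x * ((Real.sin y * Real.cos x - Real.cos y * Real.sin x)
        * Real.cos y + Real.sin x * Real.sin y ^ 2) := by positivity
  linarith

/-- Two points at distance at most `R` from a point, seen from there at an angle of at most
`π / 3`, have distance at most `R`. -/
theorem sphericalDist_le_of_bearing {b θ R : ℝ} {u v : UnitSphere}
    (hu : sphericalDist u (polarPoint b θ) ≤ R) (hv : sphericalDist v (polarPoint b θ) ≤ R)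
    (h : |bearing b θ u - bearing b θ v| ≤ Real.pi / 3) : sphericalDist u v ≤ R := by
  wlog hle : sphericalDist u (polarPoint b θ) ≤ sphericalDist v (polarPoint b θ) generalizing u v
  · rw [sphericalDist_comm]
    exact this hv hu (by rwa [abs_sub_comm]) (le_of_not_ge hle)
  refine le_trans (sphericalDist_le_of_cos_le (sphericalDist_nonneg _ _) ?_) hv
  have hc : 1 / 2 ≤ Real.cos (bearing b θ u - bearing b θ v) := by
    rw [← Real.cos_abs, ← Real.cos_pi_div_three]
    exact Real.cos_le_cos_of_nonneg_of_le_pi (abs_nonneg _) (by linarith [Real.pi_pos]) h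
  have hs : 0 ≤ Real.sin (sphericalDist u (polarPoint b θ))
      * Real.sin (sphericalDist v (polarPoint b θ)) :=
    mul_nonneg (InnerProductGeometry.sin_angle_nonneg _ _)
      (InnerProductGeometry.sin_angle_nonneg _ _)
  have hcos : Real.cos (sphericalDist u v) =
      Real.cos (sphericalDist u (polarPoint b θ)) * Real.cos (sphericalDist v (polarPoint b θ)) +
      Real.sin (sphericalDist u (polarPoint b θ)) * Real.sin (sphericalDist v (polarPoint b θ)) *
        Real.cos (bearing b θ u - bearing b θ v) := by
    conv_lhs => rw [← geodesicPoint_bearing b θ u, ← geodesicPoint_bearing b θ v]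
    exact cos_sphericalDist_geodesicPoint _ _ _ _ _ _
  rw [hcos]
  have := cos_le_of_angle_le_third (sphericalDist_nonneg u (polarPoint b θ)) hle
    (sphericalDist_le_pi v (polarPoint b θ))
  have := mul_le_mul_of_nonneg_left hc hs
  linarith

/-- The sector, out of six sectors with angle `π / 3`, in which `u` is seen from
`polarPoint b θ`. -/
noncomputable def sector (b θ : ℝ) (u : UnitSphere) : Set.Ioc (-3 : ℤ) 3 :=
  ⟨⌈bearing b θ u / (Real.pi / 3)⌉, by
    have h := Complex.arg_mem_Ioc ⟨u.1 0 * (Real.cos b * Real.cos θ) + u.1 1 * (Real.cos b *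
      Real.sin θ) - u.1 2 * Real.sin b, u.1 1 * Real.cos θ - u.1 0 * Real.sin θ⟩
    change bearing b θ u ∈ _ at h
    have hp : 0 < Real.pi / 3 := by positivity
    constructor
    · rw [Int.lt_ceil, lt_div_iff₀ hp]
      push_cast
      linarith [h.1]
    · rw [Int.ceil_le, div_le_iff₀ hp]
      push_cast
      linarith [h.2]⟩

theorem sphericalDist_le_of_sector_eq {b θ R : ℝ} {u v : UnitSphere}
    (hu : sphericalDist u (polarPoint b θ) ≤ R) (hv : sphericalDist v (polarPoint b θ) ≤ R)
    (h : sector b θ u = sector b θ v) : sphericalDist u v ≤ R := by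
  have h' : ⌈bearing b θ u / (Real.pi / 3)⌉ = ⌈bearing b θ v / (Real.pi / 3)⌉ :=
    congrArg Subtype.val h
  have hp : 0 < Real.pi / 3 := by positivity
  refine sphericalDist_le_of_bearing hu hv ?_
  have h1 := Int.le_ceil (bearing b θ u / (Real.pi / 3))
  have h2 := Int.ceil_lt_add_one (bearing b θ u / (Real.pi / 3))
  have h3 := Int.le_ceil (bearing b θ v / (Real.pi / 3))
  have h4 := Int.ceil_lt_add_one (bearing b θ v / (Real.pi / 3))
  rw [h'] at h1 h2
  have h5 : |bearing b θ u / (Real.pi / 3) - bearing b θ v / (Real.pi / 3)| ≤ 1 := by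
    rw [abs_le]
    constructor <;> linarith
  rwa [← sub_div, abs_div, abs_of_pos hp, div_le_one hp] at h5

/-! ### The polar angles on a disk -/

theorem sphericalDisk_eq_image (b θ : ℝ) {r : ℝ} (hr : r < Real.pi) :
    sphericalDisk (polarPoint b θ) r =
      (fun p : ℝ × ℝ => geodesicPoint b θ p.1 p.2) '' Set.Icc 0 r ×ˢ Set.univ := by
  ext u
  constructor
  · intro hu
    exact ⟨(sphericalDist u (polarPoint b θ), bearing b θ u),
      ⟨⟨sphericalDist_nonneg _ _, hu⟩, trivial⟩, geodesicPoint_bearing b θ u⟩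
  · rintro ⟨⟨a, φ⟩, ⟨⟨h0, h1⟩, -⟩, rfl⟩
    change sphericalDist _ _ ≤ r
    rw [sphericalDist_geodesicPoint_self b θ φ ⟨h0, by linarith⟩]
    exact h1

theorem isPreconnected_sphericalDisk (b θ : ℝ) {r : ℝ} (hr : r < Real.pi) :
    IsPreconnected (sphericalDisk (polarPoint b θ) r) := by
  rw [sphericalDisk_eq_image b θ hr]
  refine (isPreconnected_Icc.prod isPreconnected_univ).image _ (Continuous.continuousOn ?_)
  refine Continuous.subtype_mk ?_ _
  refine (PiLp.continuous_toLp 2 _).comp (continuous_pi fun i => ?_)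
  fin_cases i <;> simp <;> fun_prop

theorem continuous_sphericalDist_left (c : UnitSphere) :
    Continuous fun u : UnitSphere => sphericalDist u c := by
  unfold sphericalDist
  unfold InnerProductGeometry.angle
  have h : ∀ u : UnitSphere, ‖u.1‖ = 1 := fun u => mem_sphere_zero_iff_norm.1 u.2
  simp only [h]
  fun_prop

theorem isCompact_sphericalDisk (c : UnitSphere) (r : ℝ) : IsCompact (sphericalDisk c r) :=
  (isClosed_le (continuous_sphericalDist_left c) continuous_const).isCompact

theorem polarAngle_eq_arg_neg_add_pi {u : UnitSphere}
    (h : -(⟨u.1 0, u.1 1⟩ : ℂ) ∈ Complex.slitPlane) :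
    polarAngle u = Complex.arg (-⟨u.1 0, u.1 1⟩) + Real.pi := by
  rw [polarAngle]
  generalize (⟨u.1 0, u.1 1⟩ : ℂ) = z at *
  have hlt : Complex.arg (-z) < Real.pi :=
    lt_of_le_of_ne (Complex.arg_le_pi _) (Complex.mem_slitPlane_iff_arg.1 h).1
  rw [toIcoMod_eq_iff]
  refine ⟨⟨by linarith [Complex.neg_pi_lt_arg (-z)], by linarith⟩, ?_⟩
  rcases lt_trichotomy z.im 0 with him | him | him
  · exact ⟨-1, by rw [Complex.arg_neg_eq_arg_add_pi_of_im_neg him]; simp; ring⟩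
  · have hre : z.re < 0 := by
      rcases Complex.mem_slitPlane_iff.1 h with h | h
      · simpa using h
      · simp [him] at h
    refine ⟨0, ?_⟩
    rw [Complex.arg_eq_pi_iff.2 ⟨hre, him⟩, Complex.arg_eq_zero_iff.2 ⟨by simpa using hre.le, by
      simpa using him⟩]
    simp
  · exact ⟨0, by rw [Complex.arg_neg_eq_arg_sub_pi_of_im_pos him]; simp⟩

theorem neg_mem_slitPlane_of_polarAngle_ne_zero {u : UnitSphere} (h : polarAngle u ≠ 0) :
    -(⟨u.1 0, u.1 1⟩ : ℂ) ∈ Complex.slitPlane := by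
  by_contra hn
  rw [Complex.mem_slitPlane_iff, not_or, not_lt, not_not] at hn
  simp only [Complex.neg_re, Complex.neg_im, Left.neg_nonpos_iff, neg_eq_zero] at hn
  apply h
  rw [polarAngle, Complex.arg_eq_zero_iff.2 hn, toIcoMod_apply_left]

/-- Away from the polar axis, the polar angle is continuous. -/
theorem continuousAt_polarAngle {u : UnitSphere} (h : polarAngle u ≠ 0) :
    ContinuousAt polarAngle u := by
  have hu := neg_mem_slitPlane_of_polarAngle_ne_zero h
  have hc : Continuous fun v : UnitSphere => -(⟨v.1 0, v.1 1⟩ : ℂ) := by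
    have : ∀ v : UnitSphere, -(⟨v.1 0, v.1 1⟩ : ℂ) = -((v.1 0 : ℂ) + (v.1 1 : ℂ) * Complex.I) :=
      fun v => by rw [Complex.mk_eq_add_mul_I]
    simp only [this]
    fun_prop
  refine ContinuousAt.congr (f := fun v : UnitSphere => Complex.arg (-⟨v.1 0, v.1 1⟩) + Real.pi)
    ?_ ?_
  · exact (ContinuousAt.comp (f := fun v : UnitSphere => -(⟨v.1 0, v.1 1⟩ : ℂ))
      (Complex.continuousAt_arg hu) hc.continuousAt).add continuousAt_const
  · filter_upwards [(Complex.isOpen_slitPlane.preimage hc).mem_nhds hu] with v hv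
    exact (polarAngle_eq_arg_neg_add_pi hv).symm

/-- A disk that does not meet the polar axis meets all meridians between the extreme polar angles
on the disk. -/
theorem mem_image_polarAngle {b θ r α : ℝ} (h0 : 0 ≤ r) (hr : r < Real.pi)
    (hinf : sInf (polarAngle '' sphericalDisk (polarPoint b θ) r) ≤ α)
    (hsup : α ≤ sSup (polarAngle '' sphericalDisk (polarPoint b θ) r)) :
    0 ∈ polarAngle '' sphericalDisk (polarPoint b θ) r ∨
      α ∈ polarAngle '' sphericalDisk (polarPoint b θ) r := by
  set D := sphericalDisk (polarPoint b θ) r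
  by_cases hz : 0 ∈ polarAngle '' D
  · exact Or.inl hz
  right
  have hcont : ContinuousOn polarAngle D := fun u hu =>
    (continuousAt_polarAngle fun h => hz ⟨u, hu, h⟩).continuousWithinAt
  have hcomp := (isCompact_sphericalDisk (polarPoint b θ) r).image_of_continuousOn hcont
  have hne : (polarAngle '' D).Nonempty :=
    Set.Nonempty.image _ ⟨polarPoint b θ, by
      change InnerProductGeometry.angle _ _ ≤ r
      rw [InnerProductGeometry.angle_self]
      · exact h0
      · intro h
        have := mem_sphere_zero_iff_norm.1 (polarPoint b θ).2
        rw [h, norm_zero] at this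
        exact zero_ne_one this⟩
  exact ((isPreconnected_sphericalDisk b θ hr).image _ hcont).Icc_subset
    (hcomp.sInf_mem hne) (hcomp.sSup_mem hne) ⟨hinf, hsup⟩

/-! ### Few disjoint disks meet a meridian -/

/-- A disk that meets the meridian at angle `α` and has its center at a colatitude between `s` and
`s + 2r` has its center at distance at most `2r` from one of two points of the meridian. -/
theorem sphericalDist_le_of_mem_image_polarAngle {b θ r s α : ℝ} (hb : b ∈ Set.Icc 0 Real.pi)
    (h : α ∈ polarAngle '' sphericalDisk (polarPoint b θ) r) (hs : 0 ≤ s) (hsb : s ≤ b)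
    (hbs : b ≤ s + 2 * r) :
    sphericalDist (polarPoint b θ) (polarPoint s α) ≤ 2 * r ∨
      sphericalDist (polarPoint b θ) (polarPoint (min (s + 2 * r) Real.pi) α) ≤ 2 * r := by
  obtain ⟨u, hu, rfl⟩ := h
  change sphericalDist _ _ ≤ r at hu
  set β := Real.arccos (u.1 2)
  have hβ : β ∈ Set.Icc 0 Real.pi := ⟨Real.arccos_nonneg _, Real.arccos_le_pi _⟩
  have hpu : polarPoint β (polarAngle u) = u := polarPoint_arccos_polarAngle u
  have hd : |β - b| ≤ r := by
    refine le_trans ?_ hu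
    rw [← hpu]
    exact abs_sub_le_sphericalDist hβ hb _ _
  rw [abs_le] at hd
  have key : ∀ z ∈ Set.Icc 0 Real.pi, |β - z| ≤ r →
      sphericalDist (polarPoint b θ) (polarPoint z (polarAngle u)) ≤ 2 * r := fun z hz hzr => by
    have h1 := sphericalDist_triangle (polarPoint b θ) u (polarPoint z (polarAngle u))
    rw [sphericalDist_comm _ u] at h1
    have h2 : sphericalDist u (polarPoint z (polarAngle u)) = |β - z| := by
      rw [← sphericalDist_polarPoint_same_angle hβ hz (polarAngle u), hpu]
    linarith
  rcases le_total β (s + r) with h | h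
  · refine Or.inl (key s ⟨hs, hsb.trans hb.2⟩ ?_)
    rw [abs_le]
    constructor <;> linarith
  · refine Or.inr (key _ ⟨le_min (by linarith [hb.1]) Real.pi_pos.le, min_le_right _ _⟩ ?_)
    rw [abs_le]
    rcases min_choice (s + 2 * r) Real.pi with hm | hm
    · rw [hm]
      constructor <;> linarith
    · have := min_le_left (s + 2 * r) Real.pi
      rw [hm] at this ⊢
      constructor <;> linarith [hβ.2]

/-- An independent set of vertices whose disks all have their polar angles around `α` and whose
centers all lie in a zone of width `2r` has at most `24 = 2 · 2 · 6` elements: each disk meets one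
of the meridians at the angles `0` and `α`, each of these meridians provides two points one of which
is at distance at most `2r` from the center, and two centers in the same one of the six sectors
around this point are not independent. -/
theorem DiskInstance.indepNum_induce_le {n : ℕ} (I : DiskInstance n) {S : Set (Fin n)} {s α : ℝ}
    (hs : 0 ≤ s) (hzone : ∀ v ∈ S, s ≤ I.b v ∧ I.b v ≤ s + 2 * I.r)
    (hα : ∀ v ∈ S, I.angleInf v ≤ α ∧ α ≤ I.angleSup v) :
    (I.graph.induce S).indepNum ≤ 24 := by
  classical
  set A : Bool → ℝ := fun p => if p then α else 0 with hA
  set Z : Bool → ℝ := fun q => if q then min (s + 2 * I.r) Real.pi else s with hZ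
  set c : Fin n → UnitSphere := fun v => polarPoint (I.b v) (I.θ v) with hc
  have hpq : ∀ v : S, ∃ pq : Bool × Bool,
      sphericalDist (c v) (polarPoint (Z pq.2) (A pq.1)) ≤ 2 * I.r := fun ⟨v, hv⟩ => by
    obtain ⟨h1, h2⟩ := hα v hv
    simp only [DiskInstance.angleInf, DiskInstance.angleSup, Fin.is_lt, dif_pos] at h1 h2
    have hp : ∃ p, A p ∈ polarAngle '' sphericalDisk (c v) I.r := by
      rcases mem_image_polarAngle I.r_pos.le I.r_lt_pi h1 h2 with h | h
      · exact ⟨false, by simpa [hA] using h⟩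
      · exact ⟨true, by simpa [hA] using h⟩
    obtain ⟨p, hp⟩ := hp
    rcases sphericalDist_le_of_mem_image_polarAngle (I.b_mem v) hp hs (hzone v hv).1
      (hzone v hv).2 with h | h
    · exact ⟨(p, false), by simpa [hZ] using h⟩
    · exact ⟨(p, true), by simpa [hZ] using h⟩
  choose pq hpq using hpq
  set f : S → (Bool × Bool) × Set.Ioc (-3 : ℤ) 3 := fun v =>
    (pq v, sector (Z (pq v).2) (A (pq v).1) (c v)) with hf
  have hadj : ∀ v w : S, v ≠ w → f v = f w → (I.graph.induce S).Adj v w := fun v w hne h => by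
    rw [hf, Prod.mk.injEq] at h
    refine ⟨fun h => hne (Subtype.ext h), ?_⟩
    have hw := hpq w
    have h2 := h.2
    rw [← h.1] at hw h2
    exact (sphericalDisk_inter_nonempty_iff _ _ _ I.r_lt_pi).2
      (sphericalDist_le_of_sector_eq (hpq v) hw h2)
  obtain ⟨T, hT⟩ := (I.graph.induce S).exists_isNIndepSet_indepNum
  rw [← hT.card_eq]
  have hinj : Set.InjOn f T := fun v hv w hw h => by
    by_contra hne
    exact hT.isIndepSet hv hw hne (hadj v w hne h)
  calc T.card = (T.image f).card := (Finset.card_image_of_injOn hinj).symm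
    _ ≤ Fintype.card ((Bool × Bool) × Set.Ioc (-3 : ℤ) 3) := Finset.card_le_univ _
    _ = 24 := by simp

/-! ### Path decompositions -/

theorem SimpleGraph.pathGraph_isTree {N : ℕ} (hN : 0 < N) : (SimpleGraph.pathGraph N).IsTree := by
  obtain ⟨N, rfl⟩ := Nat.exists_eq_add_of_lt hN
  rw [Nat.zero_add]
  refine ⟨SimpleGraph.pathGraph_connected N, ?_⟩
  have key : ∀ u v : Fin (N + 1), u.val + 1 = v.val →
      (SimpleGraph.pathGraph (N + 1)).IsBridge s(u, v) := fun u v huv => by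
    rw [SimpleGraph.isBridge_iff]
    -- without the edge from `u` to `u + 1`, no walk leaves the set of the nodes up to `u`
    rintro ⟨p⟩
    have : ∀ {x y : Fin (N + 1)},
        ((SimpleGraph.pathGraph (N + 1)).deleteEdges {s(u, v)}).Walk x y → x ≤ u → y ≤ u := by
      intro x y p
      induction p with
      | nil => exact id
      | cons h _ ih =>
        intro hx
        apply ih
        rw [SimpleGraph.deleteEdges_adj, SimpleGraph.pathGraph_adj, Set.mem_singleton_iff,
          Sym2.eq_iff] at h
        simp only [Fin.le_def, Fin.ext_iff] at *
        omega
    have := this p le_rfl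
    rw [Fin.le_def] at this
    omega
  rw [SimpleGraph.isAcyclic_iff_forall_adj_isBridge]
  intro u v h
  rw [SimpleGraph.pathGraph_adj] at h
  rcases h with h | h
  · exact key u v h
  · rw [Sym2.eq_swap]
    exact key v u h

theorem SimpleGraph.pathGraph_induce_interval_connected {N a b : ℕ} (hab : a ≤ b) (hb : b < N) :
    ((SimpleGraph.pathGraph N).induce {t : Fin N | a ≤ (t : ℕ) ∧ (t : ℕ) ≤ b}).Connected := by
  set S : Set (Fin N) := {t | a ≤ (t : ℕ) ∧ (t : ℕ) ≤ b}
  have h0 : (⟨a, hab.trans_lt hb⟩ : Fin N) ∈ S := ⟨le_rfl, hab⟩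
  have key : ∀ k (hk : a + k ≤ b), ((SimpleGraph.pathGraph N).induce S).Reachable ⟨_, h0⟩
      ⟨⟨a + k, hk.trans_lt hb⟩, ⟨Nat.le_add_right a k, hk⟩⟩ := by
    intro k
    induction k with
    | zero => exact fun _ => SimpleGraph.Reachable.refl _
    | succ k ih =>
      intro hk
      refine (ih (by omega)).trans (SimpleGraph.Adj.reachable ?_)
      exact SimpleGraph.pathGraph_adj.2 (Or.inl (by simp; omega))
  have : Nonempty S := ⟨⟨_, h0⟩⟩
  refine ⟨fun x y => ?_⟩
  have hx : ∀ x : S, ((SimpleGraph.pathGraph N).induce S).Reachable ⟨_, h0⟩ x := by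
    rintro ⟨⟨x, hxN⟩, hx1, hx2⟩
    obtain ⟨k, rfl⟩ := Nat.exists_eq_add_of_le hx1
    exact key k hx2
  exact (hx x).symm.trans (hx y)

/-- The path decomposition in which the vertex `v` lies in the bags of the nodes from `lo v` to
`hi v`. -/
def pathDecomposition {V : Type*} (G : SimpleGraph V) (N : ℕ) (lo hi : V → ℕ) (hN : 0 < N)
    (hhi : ∀ v, hi v < N) (hle : ∀ v, lo v ≤ hi v) (hadj : ∀ u v, G.Adj u v → lo u ≤ hi v) :
    TreeDecomposition G where
  size := N
  tree := SimpleGraph.pathGraph N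
  isTree := SimpleGraph.pathGraph_isTree hN
  bag t := {v | lo v ≤ (t : ℕ) ∧ (t : ℕ) ≤ hi v}
  exists_mem_bag v := ⟨⟨lo v, (hle v).trans_lt (hhi v)⟩, le_rfl, hle v⟩
  exists_edge_bag u v h :=
    ⟨⟨max (lo u) (lo v), max_lt ((hle u).trans_lt (hhi u)) ((hle v).trans_lt (hhi v))⟩,
      ⟨le_max_left _ _, max_le (hle u) (hadj v u h.symm)⟩,
      ⟨le_max_right _ _, max_le (hadj u v h) (hle v)⟩⟩
  connected_nodes v := SimpleGraph.pathGraph_induce_interval_connected (hle v) (hhi v)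

/-! ### The decomposition of a spherical uniform disk graph -/

theorem bddBelow_image_polarAngle (D : Set UnitSphere) : BddBelow (polarAngle '' D) :=
  ⟨0, by rintro _ ⟨u, -, rfl⟩; exact (polarAngle_mem u).1⟩

theorem bddAbove_image_polarAngle (D : Set UnitSphere) : BddAbove (polarAngle '' D) :=
  ⟨2 * Real.pi, by rintro _ ⟨u, -, rfl⟩; exact (polarAngle_mem u).2.le⟩

namespace DiskInstance

variable {n : ℕ} (I : DiskInstance n)

theorem angleInf_le_angleSup_of_adj {u v : Fin n} (h : I.graph.Adj u v) :
    I.angleInf u ≤ I.angleSup v := by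
  obtain ⟨-, x, hu, hv⟩ := h
  simp only [angleInf, angleSup, Fin.is_lt, dif_pos]
  exact (csInf_le (bddBelow_image_polarAngle _) ⟨x, hu, rfl⟩).trans
    (le_csSup (bddAbove_image_polarAngle _) ⟨x, hv, rfl⟩)

theorem angleInf_le_angleSup (v : Fin n) : I.angleInf v ≤ I.angleSup v := by
  simp only [angleInf, angleSup, Fin.is_lt, dif_pos]
  have h : (I.disk v).Nonempty := by
    have := (sphericalDisk_inter_nonempty_iff (I.b v) (I.θ v) (polarPoint (I.b v) (I.θ v))
      I.r_lt_pi).2 (by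
        rw [sphericalDist_eq_of_cos_eq le_rfl Real.pi_pos.le]
        · linarith [I.r_pos]
        · rw [cos_sphericalDist, Real.cos_zero]
          linarith [(polarPoint (I.b v) (I.θ v)).sum_sq])
    exact this.mono Set.inter_subset_left
  obtain ⟨x, hx⟩ := h
  exact (csInf_le (bddBelow_image_polarAngle _) ⟨x, hx, rfl⟩).trans
    (le_csSup (bddAbove_image_polarAngle _) ⟨x, hx, rfl⟩)

theorem abs_sub_le_of_adj {u v : Fin n} (h : I.graph.Adj u v) : |I.b u - I.b v| ≤ 2 * I.r :=
  (abs_sub_le_sphericalDist (I.b_mem u) (I.b_mem v) (I.θ u) (I.θ v)).trans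
    ((sphericalDisk_inter_nonempty_iff _ _ _ I.r_lt_pi).1 h.2)

/-- Layers of width `2r` together with intervals of nodes that are ordered like the intervals of
polar angles of the disks give a layering and a path decomposition of small layered independence
number. -/
theorem exists_witness {N : ℕ} (hN : 0 < N) (lo hi lay : Fin n → ℕ)
    (hhi : ∀ v, hi v < N)
    (hlohi : ∀ u v : Fin n, I.angleInf u ≤ I.angleSup v → lo u ≤ hi v)
    (hangle : ∀ t < N, ∃ α, ∀ v : Fin n, lo v ≤ t → t ≤ hi v →
      I.angleInf v ≤ α ∧ α ≤ I.angleSup v)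
    (hfar : ∀ u v, lay v + 1 < lay u → I.b v + 2 * I.r < I.b u)
    (hzone : ∀ i, ∃ s, 0 ≤ s ∧ ∀ v, lay v = i → s ≤ I.b v ∧ I.b v ≤ s + 2 * I.r) :
    ∃ (𝒯 : TreeDecomposition I.graph) (L : Layering I.graph),
      𝒯.size = N ∧ 𝒯.tree = SimpleGraph.pathGraph 𝒯.size ∧
      (∀ t v, v ∈ 𝒯.bag t ↔ lo v ≤ (t : ℕ) ∧ (t : ℕ) ≤ hi v) ∧
      (∀ v, L.idx v = lay v) ∧ 𝒯.Witnesses L 30 := by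
  refine ⟨pathDecomposition I.graph N lo hi hN hhi
    (fun v => hlohi v v (I.angleInf_le_angleSup v))
    (fun u v h => hlohi u v (I.angleInf_le_angleSup_of_adj h)),
    ⟨lay, fun u v h => ?_⟩, rfl, rfl, fun t v => Iff.rfl, fun v => rfl, fun t i => ?_⟩
  · by_contra! hlt
    linarith [hfar u v hlt, (abs_le.1 (I.abs_sub_le_of_adj h)).2]
  · obtain ⟨α, hα⟩ := hangle t t.2
    obtain ⟨s, hs, hz⟩ := hzone i
    exact (I.indepNum_induce_le hs (fun v hv => hz v hv.2)
      (fun v hv => hα v hv.1.1 hv.1.2)).trans (by norm_num)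

end DiskInstance

/-! ### Transport along isomorphisms -/

theorem indepNum_le_of_embedding {V W : Type*} [Finite V] [Finite W] {G : SimpleGraph V}
    {H : SimpleGraph W} (f : G ↪g H) : G.indepNum ≤ H.indepNum := by
  classical
  have := Fintype.ofFinite V
  have := Fintype.ofFinite W
  obtain ⟨T, hT⟩ := G.exists_isNIndepSet_indepNum
  rw [← hT.card_eq, ← Finset.card_map f.toEmbedding]
  apply SimpleGraph.IsIndepSet.card_le_indepNum
  rw [Finset.coe_map]
  rintro _ ⟨x, hx, rfl⟩ _ ⟨y, hy, rfl⟩ hne hadj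
  exact hT.isIndepSet hx hy (fun h => hne (by rw [h])) (f.map_adj_iff.1 hadj)

/-- The tree decomposition with the same tree that is pulled back along an isomorphism. -/
def TreeDecomposition.comap {V W : Type*} {G : SimpleGraph V} {H : SimpleGraph W} (e : G ≃g H)
    (𝒯 : TreeDecomposition H) : TreeDecomposition G where
  size := 𝒯.size
  tree := 𝒯.tree
  isTree := 𝒯.isTree
  bag t := e ⁻¹' 𝒯.bag t
  exists_mem_bag v := 𝒯.exists_mem_bag (e v)
  exists_edge_bag u v h := 𝒯.exists_edge_bag (e u) (e v) (e.map_adj_iff.2 h)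
  connected_nodes v := 𝒯.connected_nodes (e v)

/-- The layering that is pulled back along an isomorphism. -/
def Layering.comap {V W : Type*} {G : SimpleGraph V} {H : SimpleGraph W} (e : G ≃g H)
    (L : Layering H) : Layering G where
  idx v := L.idx (e v)
  adj_le u v h := L.adj_le (e u) (e v) (e.map_adj_iff.2 h)

theorem TreeDecomposition.Witnesses.comap {V W : Type*} [Finite W] {G : SimpleGraph V}
    {H : SimpleGraph W} (e : G ≃g H) {𝒯 : TreeDecomposition H} {L : Layering H} {k : ℕ}
    (h : 𝒯.Witnesses L k) : (𝒯.comap e).Witnesses (L.comap e) k := fun t i => by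
  have : Finite V := Finite.of_equiv W e.toEquiv.symm
  let f : G.induce ((𝒯.comap e).bag t ∩ (L.comap e).layer i) ↪g
      H.induce (𝒯.bag t ∩ L.layer i) :=
    { toFun := fun v => ⟨e v.1, v.2⟩
      inj' := fun v w hvw => Subtype.ext (e.injective (congrArg Subtype.val hvw))
      map_rel_iff' := e.map_adj_iff }
  exact (indepNum_le_of_embedding f).trans (h t i)

theorem TreeDecomposition.Witnesses.layeredTreeIndependenceNumber_le {V : Type*}
    {G : SimpleGraph V} {𝒯 : TreeDecomposition G} {L : Layering G} {k : ℕ}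
    (h : 𝒯.Witnesses L k) : layeredTreeIndependenceNumber G ≤ k :=
  have hk : 𝒯.layeredIndependenceNumber ≤ k := Nat.sInf_le ⟨L, h⟩
  (Nat.sInf_le (Set.mem_range_self 𝒯)).trans hk

/-- Every nonempty spherical uniform disk graph is the graph of an instance. -/
theorem IsSphericalUniformDiskGraph.exists_instance {V : Type*} [Finite V] {G : SimpleGraph V}
    {r : ℝ} (h : IsSphericalUniformDiskGraph G r) :
    ∃ I : DiskInstance (Nat.card V), Nonempty (G ≃g I.graph) := by
  obtain ⟨h0, hpi, c, rfl⟩ := h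
  let e := Finite.equivFin V
  let I : DiskInstance (Nat.card V) :=
    { r := r
      r_pos := h0
      r_lt_pi := hpi
      b := fun i => Real.arccos ((c (e.symm i)).1 2)
      b_mem := fun i => ⟨Real.arccos_nonneg _, Real.arccos_le_pi _⟩
      θ := fun i => polarAngle (c (e.symm i))
      θ_mem := fun i => polarAngle_mem _ }
  refine ⟨I, ⟨e, fun {u v} => ?_⟩⟩
  have hd : ∀ v, I.disk (e v) = sphericalDisk (c v) r := fun v => by
    simp [I, DiskInstance.disk, polarPoint_arccos_polarAngle]
  simp only [DiskInstance.graph, intersectionGraph, hd, ne_eq, e.injective.eq_iff]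

/-- The graph without vertices has a tree decomposition with a single empty bag. -/
theorem layeredTreeIndependenceNumber_of_isEmpty {V : Type*} [IsEmpty V] (G : SimpleGraph V) :
    layeredTreeIndependenceNumber G ≤ 30 := by
  let 𝒯 : TreeDecomposition G := pathDecomposition G 1 (fun _ => 0) (fun _ => 0) one_pos
    (fun _ => one_pos) (fun _ => le_rfl) (fun _ _ _ => le_rfl)
  let L : Layering G := ⟨fun _ => 0, fun _ _ _ => Nat.zero_le _⟩
  refine TreeDecomposition.Witnesses.layeredTreeIndependenceNumber_le (𝒯 := 𝒯) (L := L)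
    fun t i => ?_
  obtain ⟨T, hT⟩ := (G.induce (𝒯.bag t ∩ L.layer i)).exists_isNIndepSet_indepNum
  rw [← hT.card_eq, Finset.eq_empty_of_isEmpty T]
  simp

/-! ### Program logic for the real RAM -/

namespace RealRAM

/-- Weakest precondition with a time bound: started in `s`, the program `p` halts after at most
`T` steps in a state that satisfies `Q`. -/
def Wp (inf sup : ℕ → ℝ) (p : Prog) (T : ℕ) (Q : State → Prop) (s : State) : Prop :=
  ∃ t s', Exec inf sup p s t s' ∧ t ≤ T ∧ Q s'

/-- A straight-line program. -/
def Prog.ofList : List Instr → Prog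
  | [] => .skip
  | c :: l => .seq (.instr c) (ofList l)

namespace Wp

variable {inf sup : ℕ → ℝ} {p q : Prog} {T T' : ℕ} {Q Q' : State → Prop} {s : State} {b : Test}

theorem mono (h : Wp inf sup p T Q s) (hT : T ≤ T') (hQ : ∀ s', Q s' → Q' s') :
    Wp inf sup p T' Q' s := by
  obtain ⟨t, s', he, ht, hq⟩ := h
  exact ⟨t, s', he, ht.trans hT, hQ s' hq⟩

theorem skip (h : Q s) : Wp inf sup .skip 0 Q s := ⟨0, s, .skip s, le_rfl, h⟩

theorem seq (h : Wp inf sup p T (Wp inf sup q T' Q) s) : Wp inf sup (.seq p q) (T + T') Q s := by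
  obtain ⟨t, s', he, ht, t', s'', he', ht', hq⟩ := h
  exact ⟨t + t', s'', .seq he he', add_le_add ht ht', hq⟩

theorem ofList {l : List Instr} (h : Q (l.foldl (fun s c => c.step inf sup s) s)) :
    Wp inf sup (.ofList l) l.length Q s := by
  induction l generalizing s with
  | nil => exact skip h
  | cons c l ih =>
    rw [List.length_cons, add_comm]
    exact seq ⟨1, _, .instr c s, le_rfl, ih h⟩

theorem ite (h₁ : b.Holds s → Wp inf sup p T Q s) (h₂ : ¬ b.Holds s → Wp inf sup q T Q s) :
    Wp inf sup (.ite b p q) (T + 1) Q s := by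
  by_cases hb : b.Holds s
  · obtain ⟨t, s', he, ht, hq⟩ := h₁ hb
    exact ⟨t + 1, s', .iteTrue hb he, by omega, hq⟩
  · obtain ⟨t, s', he, ht, hq⟩ := h₂ hb
    exact ⟨t + 1, s', .iteFalse hb he, by omega, hq⟩

/-- The rule for loops. The invariant `J k` holds with a credit of `k` steps; each pass through the
loop pays for its test and its body from the credit. -/
theorem while_credit (J : ℕ → State → Prop) {k : ℕ} (hs : J k s)
    (body : ∀ k s, J k s → b.Holds s → ∃ T k', T + 1 + k' ≤ k ∧ Wp inf sup p T (J k') s) :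
    Wp inf sup (.while b p) (k + 1) (fun s' => (∃ k', J k' s') ∧ ¬ b.Holds s') s := by
  induction k using Nat.strong_induction_on generalizing s with
  | _ k ih =>
    by_cases hb : b.Holds s
    · obtain ⟨T, k', hk, t, s', he, ht, hJ⟩ := body k s hs hb
      obtain ⟨t', s'', he', ht', hQ⟩ := ih k' (by omega) hJ
      exact ⟨t + t' + 1, s'', .whileTrue hb he he', by omega, hQ⟩
    · exact ⟨1, s, .whileFalse hb, by omega, ⟨k, hs⟩, hb⟩

/-- The rule for loops that count up to `N`, with a bound `T` on the cost of each pass. -/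
theorem while_count (J : ℕ → State → Prop) (N T : ℕ) (hs : J 0 s)
    (hb : ∀ k s, k ≤ N → J k s → (b.Holds s ↔ k < N))
    (body : ∀ k s, k < N → J k s → Wp inf sup p T (J (k + 1)) s) :
    Wp inf sup (.while b p) (N * (T + 1) + 1) (J N) s := by
  refine (while_credit (fun c s => ∃ k ≤ N, c = (N - k) * (T + 1) ∧ J k s)
    ⟨0, Nat.zero_le _, rfl, hs⟩ ?_).mono le_rfl ?_
  · rintro _ s ⟨k, hk, rfl, hJ⟩ hbs
    have hlt := (hb k s hk hJ).1 hbs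
    refine ⟨T, (N - (k + 1)) * (T + 1), ?_, (body k s hlt hJ).mono le_rfl
      fun s' hs' => ⟨k + 1, hlt, rfl, hs'⟩⟩
    rw [show N - k = N - (k + 1) + 1 by omega]
    ring_nf
    omega
  · rintro s ⟨⟨_, k, hk, -, hJ⟩, hbs⟩
    have : k = N := le_antisymm hk (not_lt.1 fun h => hbs ((hb k s hk hJ).2 h))
    exact this ▸ hJ

end Wp

/-! ### Reading the memory after an update -/

namespace State

variable (s : State) (d i j a x : ℕ) (y : ℝ)

@[simp] theorem setNat_nat : (s.setNat d x).nat i = if i = d then x else s.nat i := by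
  simp [setNat, Function.update_apply]

@[simp] theorem setNat_setNat (x' : ℕ) : (s.setNat d x).setNat d x' = s.setNat d x' := by
  simp [setNat]

@[simp] theorem setNat_real : (s.setNat d x).real = s.real := rfl
@[simp] theorem setNat_natArr : (s.setNat d x).natArr = s.natArr := rfl
@[simp] theorem setNat_realArr : (s.setNat d x).realArr = s.realArr := rfl

@[simp] theorem setReal_real : (s.setReal d y).real i = if i = d then y else s.real i := by
  simp [setReal, Function.update_apply]

@[simp] theorem setReal_nat : (s.setReal d y).nat = s.nat := rfl
@[simp] theorem setReal_natArr : (s.setReal d y).natArr = s.natArr := rfl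
@[simp] theorem setReal_realArr : (s.setReal d y).realArr = s.realArr := rfl

theorem setNatArr_natArr :
    (s.setNatArr a i x).natArr j = if j = a then Function.update (s.natArr a) i x
      else s.natArr j := by
  simp [setNatArr, Function.update_apply]

@[simp] theorem setNatArr_natArr_self :
    (s.setNatArr a i x).natArr a = Function.update (s.natArr a) i x := by
  simp [setNatArr]

@[simp] theorem setNatArr_nat : (s.setNatArr a i x).nat = s.nat := rfl
@[simp] theorem setNatArr_real : (s.setNatArr a i x).real = s.real := rfl
@[simp] theorem setNatArr_realArr : (s.setNatArr a i x).realArr = s.realArr := rfl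

@[simp] theorem setRealArr_realArr :
    (s.setRealArr a i y).realArr j = if j = a then Function.update (s.realArr a) i y
      else s.realArr j := by
  simp [setRealArr, Function.update_apply]

@[simp] theorem setRealArr_nat : (s.setRealArr a i y).nat = s.nat := rfl
@[simp] theorem setRealArr_real : (s.setRealArr a i y).real = s.real := rfl
@[simp] theorem setRealArr_natArr : (s.setRealArr a i y).natArr = s.natArr := rfl

end State

end RealRAM

/-! ### Ranks and merging -/

/-- The order in which the indices are sorted: by their keys, and by the indices themselves if the
keys are equal. -/
def KeyLT (key : ℕ → ℝ) (x y : ℕ) : Prop := key x < key y ∨ key x = key y ∧ x < y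

namespace KeyLT

variable {key : ℕ → ℝ} {x y z : ℕ}

theorem irrefl (x : ℕ) : ¬ KeyLT key x x := by simp [KeyLT]

theorem trans (h : KeyLT key x y) (h' : KeyLT key y z) : KeyLT key x z := by
  rcases h with h | ⟨h, hl⟩ <;> rcases h' with h' | ⟨h', hl'⟩
  · exact Or.inl (h.trans h')
  · exact Or.inl (h' ▸ h)
  · exact Or.inl (h ▸ h')
  · exact Or.inr ⟨h.trans h', hl.trans hl'⟩

theorem total (hne : x ≠ y) : KeyLT key x y ∨ KeyLT key y x := by
  rcases lt_trichotomy (key x) (key y) with h | h | h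
  · exact Or.inl (Or.inl h)
  · rcases Nat.lt_or_gt_of_ne hne with h' | h'
    · exact Or.inl (Or.inr ⟨h, h'⟩)
    · exact Or.inr (Or.inr ⟨h.symm, h'⟩)
  · exact Or.inr (Or.inl h)

theorem key_le (h : KeyLT key x y) : key x ≤ key y := by
  rcases h with h | h
  · exact h.le
  · exact h.1.le

end KeyLT

open Classical in
/-- The number of elements of `S` that precede `x`. -/
noncomputable def keyRank (key : ℕ → ℝ) (S : Finset ℕ) (x : ℕ) : ℕ :=
  (S.filter fun y => KeyLT key y x).card

section keyRank

variable {key : ℕ → ℝ} {S T : Finset ℕ} {x y : ℕ}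

theorem keyRank_le_card : keyRank key S x ≤ S.card := by
  classical
  unfold keyRank
  exact Finset.card_filter_le _ _

theorem keyRank_le (h : KeyLT key x y) : keyRank key S x ≤ keyRank key S y := by
  apply Finset.card_le_card
  intro z hz
  simp only [Finset.mem_filter] at hz ⊢
  exact ⟨hz.1, hz.2.trans h⟩

theorem keyRank_lt (hx : x ∈ S) (h : KeyLT key x y) : keyRank key S x < keyRank key S y := by
  classical
  apply Finset.card_lt_card
  rw [Finset.ssubset_iff_of_subset]
  · refine ⟨x, by simp [hx, h], by simp [KeyLT.irrefl]⟩
  · intro z hz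
    simp only [Finset.mem_filter] at hz ⊢
    exact ⟨hz.1, hz.2.trans h⟩

theorem keyRank_lt_iff (hx : x ∈ S) (hy : y ∈ S) :
    keyRank key S x < keyRank key S y ↔ KeyLT key x y := by
  refine ⟨fun h => ?_, keyRank_lt hx⟩
  rcases eq_or_ne x y with rfl | hne
  · exact absurd h (lt_irrefl _)
  · exact (KeyLT.total hne).resolve_right fun h' => absurd (keyRank_lt hy h') (by omega)

theorem keyRank_lt_card (hx : x ∈ S) : keyRank key S x < S.card := by
  classical
  apply Finset.card_lt_card
  exact Finset.filter_ssubset.2 ⟨x, hx, KeyLT.irrefl x⟩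

theorem keyRank_inj (hx : x ∈ S) (hy : y ∈ S) (h : keyRank key S x = keyRank key S y) : x = y := by
  by_contra hne
  rcases KeyLT.total (key := key) hne with h' | h'
  · exact absurd (keyRank_lt hx h') (by omega)
  · exact absurd (keyRank_lt hy h') (by omega)

theorem exists_keyRank_eq {k : ℕ} (hk : k < S.card) : ∃ x ∈ S, keyRank key S x = k := by
  have := Finset.surj_on_of_inj_on_of_card_le (s := S) (t := Finset.range S.card)
    (fun x _ => keyRank key S x) (fun x hx => Finset.mem_range.2 (keyRank_lt_card hx))
    (fun x y hx hy h => keyRank_inj hx hy h) (by simp) k (Finset.mem_range.2 hk)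
  obtain ⟨x, hx, h⟩ := this
  exact ⟨x, hx, h.symm⟩

theorem keyRank_union_of_disjoint (h : Disjoint S T) :
    keyRank key (S ∪ T) x = keyRank key S x + keyRank key T x := by
  classical
  unfold keyRank
  rw [Finset.filter_union]
  exact Finset.card_union_of_disjoint (Finset.disjoint_filter_filter h)

theorem keyRank_Ico {L e f : ℕ} (hLe : L ≤ e) (hef : e ≤ f) :
    keyRank key (Finset.Ico L f) x =
      keyRank key (Finset.Ico L e) x + keyRank key (Finset.Ico e f) x := by
  rw [← Finset.Ico_union_Ico_eq_Ico hLe hef,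
    keyRank_union_of_disjoint (Finset.Ico_disjoint_Ico_consecutive L e f)]

end keyRank

/-- The segment of `g` from `L` to `R` lists the indices from `L` to `R` in the order of their
keys. -/
def SortedOn (key : ℕ → ℝ) (L R : ℕ) (g : ℕ → ℕ) : Prop :=
  ∀ x ∈ Finset.Ico L R, g (L + keyRank key (Finset.Ico L R) x) = x

namespace SortedOn

variable {key : ℕ → ℝ} {L R : ℕ} {g g' : ℕ → ℕ}

theorem of_le (h : R ≤ L) : SortedOn key L R g := fun x hx => by
  rw [Finset.mem_Ico] at hx
  omega

theorem of_le_succ (h : R ≤ L + 1) (hg : g L = L) : SortedOn key L R g := fun x hx => by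
  have hc := keyRank_lt_card (key := key) hx
  rw [Nat.card_Ico] at hc
  rw [Finset.mem_Ico] at hx
  rw [show keyRank key (Finset.Ico L R) x = 0 by omega, add_zero, hg]
  omega

theorem congr (h : SortedOn key L R g) (hg : ∀ p, L ≤ p → p < R → g' p = g p) :
    SortedOn key L R g' := fun x hx => by
  have hc := keyRank_lt_card (key := key) hx
  rw [Nat.card_Ico] at hc
  rw [hg _ (by omega) (by omega), h x hx]

theorem get (h : SortedOn key L R g) {p : ℕ} (hL : L ≤ p) (hR : p < R) :
    g p ∈ Finset.Ico L R ∧ L + keyRank key (Finset.Ico L R) (g p) = p := by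
  obtain ⟨x, hx, hr⟩ := exists_keyRank_eq (key := key) (S := Finset.Ico L R) (k := p - L)
    (by rw [Nat.card_Ico]; omega)
  have hp : L + keyRank key (Finset.Ico L R) x = p := by omega
  have := h x hx
  rw [hp] at this
  rw [this]
  exact ⟨hx, hp⟩

end SortedOn

/-- The state of merging the segments from `L` to `e` and from `e` to `f` when the elements before
`i` and `j` have been consumed: the elements that are left are preceded by all consumed ones, and
`h` lists the consumed ones in order. -/
structure MergeInv (key : ℕ → ℝ) (L e f i j : ℕ) (h : ℕ → ℕ) : Prop where
  le_right : ∀ x ∈ Finset.Ico L e, i ≤ L + keyRank key (Finset.Ico L e) x →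
    j ≤ e + keyRank key (Finset.Ico e f) x
  le_left : ∀ y ∈ Finset.Ico e f, j ≤ e + keyRank key (Finset.Ico e f) y →
    i ≤ L + keyRank key (Finset.Ico L e) y
  out_left : ∀ x ∈ Finset.Ico L e, L + keyRank key (Finset.Ico L e) x < i →
    L + keyRank key (Finset.Ico L f) x + e < i + j ∧ h (L + keyRank key (Finset.Ico L f) x) = x
  out_right : ∀ y ∈ Finset.Ico e f, e + keyRank key (Finset.Ico e f) y < j →
    L + keyRank key (Finset.Ico L f) y + e < i + j ∧ h (L + keyRank key (Finset.Ico L f) y) = y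

namespace MergeInv

variable {key : ℕ → ℝ} {L e f i j : ℕ} {g h h' : ℕ → ℕ}

theorem init : MergeInv key L e f L e h where
  le_right _ _ _ := by omega
  le_left _ _ _ := by omega
  out_left _ _ _ := by omega
  out_right _ _ _ := by omega

/-- The element `g i` of the left segment is the next one. -/
theorem step_left (H : MergeInv key L e f i j h) (hLe : L ≤ e) (hef : e ≤ f)
    (hg : SortedOn key L e g) (hg' : SortedOn key e f g) (hi : L ≤ i) (hie : i < e) (hj : e ≤ j)
    (hjf : j ≤ f) (hlt : j < f → KeyLT key (g i) (g j)) (hh : ∀ p, p + e < i + j → h' p = h p)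
    (hp : ∀ p, p + e = i + j → h' p = g i) : MergeInv key L e f (i + 1) j h' := by
  obtain ⟨hiS, hir⟩ := hg.get hi hie
  -- the rank of `g i` in the right segment is the number of elements consumed there
  have hrank : e + keyRank key (Finset.Ico e f) (g i) = j := by
    have h1 := H.le_right _ hiS hir.ge
    rcases Nat.lt_or_ge j f with hjf | hjf
    · have h2 := (hg'.get hj hjf).2
      have h3 := keyRank_le (S := Finset.Ico e f) (hlt hjf)
      omega
    · have h2 := keyRank_le_card (key := key) (S := Finset.Ico e f) (x := g i)
      rw [Nat.card_Ico] at h2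
      omega
  refine ⟨fun x hx hix => H.le_right x hx (by omega), fun y hy hjy => ?_, fun x hx hxi => ?_,
    fun y hy hyj => ?_⟩
  · have hne : g i ≠ y := by
      rintro rfl
      rw [Finset.mem_Ico] at hiS hy
      omega
    rcases KeyLT.total (key := key) hne with hlt' | hlt'
    · have := keyRank_lt hiS hlt'
      omega
    · have := keyRank_lt hy hlt'
      omega
  · rcases Nat.lt_succ_iff_lt_or_eq.1 hxi with hxi | hxi
    · obtain ⟨h1, h2⟩ := H.out_left x hx hxi
      exact ⟨by omega, by rw [hh _ h1, h2]⟩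
    · obtain rfl : x = g i := keyRank_inj (key := key) hx hiS (by omega)
      rw [keyRank_Ico hLe hef]
      exact ⟨by omega, hp _ (by omega)⟩
  · obtain ⟨h1, h2⟩ := H.out_right y hy hyj
    exact ⟨by omega, by rw [hh _ h1, h2]⟩

/-- The element `g j` of the right segment is the next one. -/
theorem step_right (H : MergeInv key L e f i j h) (hLe : L ≤ e) (hef : e ≤ f)
    (hg : SortedOn key L e g) (hg' : SortedOn key e f g) (hi : L ≤ i) (hie : i ≤ e) (hj : e ≤ j)
    (hjf : j < f) (hlt : i < e → KeyLT key (g j) (g i)) (hh : ∀ p, p + e < i + j → h' p = h p)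
    (hp : ∀ p, p + e = i + j → h' p = g j) : MergeInv key L e f i (j + 1) h' := by
  obtain ⟨hjS, hjr⟩ := hg'.get hj hjf
  have hrank : L + keyRank key (Finset.Ico L e) (g j) = i := by
    have h1 := H.le_left _ hjS hjr.ge
    rcases Nat.lt_or_ge i e with hie | hie
    · have h2 := (hg.get hi hie).2
      have h3 := keyRank_le (S := Finset.Ico L e) (hlt hie)
      omega
    · have h2 := keyRank_le_card (key := key) (S := Finset.Ico L e) (x := g j)
      rw [Nat.card_Ico] at h2
      omega
  refine ⟨fun x hx hix => ?_, fun y hy hjy => H.le_left y hy (by omega), fun x hx hxi => ?_,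
    fun y hy hyj => ?_⟩
  · have hne : g j ≠ x := by
      rintro rfl
      rw [Finset.mem_Ico] at hjS hx
      omega
    rcases KeyLT.total (key := key) hne with hlt' | hlt'
    · have := keyRank_lt hjS hlt'
      omega
    · have := keyRank_lt hx hlt'
      omega
  · obtain ⟨h1, h2⟩ := H.out_left x hx hxi
    exact ⟨by omega, by rw [hh _ h1, h2]⟩
  · rcases Nat.lt_succ_iff_lt_or_eq.1 hyj with hyj | hyj
    · obtain ⟨h1, h2⟩ := H.out_right y hy hyj
      exact ⟨by omega, by rw [hh _ h1, h2]⟩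
    · obtain rfl : y = g j := keyRank_inj (key := key) hy hjS (by omega)
      rw [keyRank_Ico hLe hef]
      exact ⟨by omega, hp _ (by omega)⟩

theorem sortedOn (H : MergeInv key L e f e f h) : SortedOn key L f h := fun x hx => by
  rcases Nat.lt_or_ge x e with hxe | hxe
  · have hx : x ∈ Finset.Ico L e := Finset.mem_Ico.2 ⟨(Finset.mem_Ico.1 hx).1, hxe⟩
    have hc := keyRank_lt_card (key := key) hx
    rw [Nat.card_Ico] at hc
    exact (H.out_left x hx (by omega)).2
  · have hx : x ∈ Finset.Ico e f := Finset.mem_Ico.2 ⟨hxe, (Finset.mem_Ico.1 hx).2⟩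
    have hc := keyRank_lt_card (key := key) hx
    rw [Nat.card_Ico] at hc
    exact (H.out_right x hx (by omega)).2

end MergeInv

/-- `g` lists the indices below `m` block by block, in blocks of `w` consecutive indices, each
block in the order of the keys. -/
def BlockSorted (key : ℕ → ℝ) (w m : ℕ) (g : ℕ → ℕ) : Prop :=
  ∀ q, SortedOn key (min (q * w) m) (min ((q + 1) * w) m) g

theorem BlockSorted.sortedOn {key : ℕ → ℝ} {w m : ℕ} {g : ℕ → ℕ} (h : BlockSorted key w m g)
    (hm : m ≤ w) : SortedOn key 0 m g := by
  simpa [hm] using h 0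

theorem blockSorted_one {key : ℕ → ℝ} {m : ℕ} {g : ℕ → ℕ} (hg : ∀ x < m, g x = x) :
    BlockSorted key 1 m g := fun q => by
  rcases Nat.lt_or_ge q m with h | h
  · exact SortedOn.of_le_succ (by omega) (by simpa [h.le] using hg q h)
  · exact SortedOn.of_le (by omega)

/-! ### Merge sort on the real RAM -/

namespace RealRAM

/-- The states `s` and `s'` agree on the arrays except for the array `A` of natural numbers, on the
natural registers below `D`, and on the real register `0`. -/
structure Frame (A D : ℕ) (s s' : State) : Prop where
  realArr : s'.realArr = s.realArr
  real : s'.real 0 = s.real 0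
  natArr : ∀ a, a ≠ A → s'.natArr a = s.natArr a
  nat : ∀ d, d < D → s'.nat d = s.nat d

namespace Frame

variable {A D D' : ℕ} {s s' s'' : State}

theorem refl : Frame A D s s := ⟨rfl, rfl, fun _ _ => rfl, fun _ _ => rfl⟩

theorem trans (h : Frame A D s s') (h' : Frame A D s' s'') : Frame A D s s'' :=
  ⟨h'.realArr.trans h.realArr, h'.real.trans h.real,
    fun a ha => (h'.natArr a ha).trans (h.natArr a ha),
    fun d hd => (h'.nat d hd).trans (h.nat d hd)⟩

theorem mono (h : Frame A D s s') (hD : D' ≤ D) : Frame A D' s s' :=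
  ⟨h.realArr, h.real, h.natArr, fun d hd => h.nat d (hd.trans_le hD)⟩

end Frame

/-! The natural registers of the sorting program: `2` holds the number `m` of items, `3` the number
`1`, `4` the width `w` of the blocks, `5` and `6` the offsets in the array `A` of the current list
and of the next list, `7` and `8` the ends of the two blocks that are being merged, `9` the output
position, `10` and `11` the positions in the two blocks. -/

/-- Append the item at the position in register `d` to the output. -/
def takeItem (A d : ℕ) : Prog :=
  .ofList [.natAdd 12 5 d, .natLoad 13 A 12, .natAdd 12 6 9, .natStore A 12 13, .natAdd d d 3,
    .natAdd 9 9 3]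

/-- One step of merging two blocks. -/
def mergeStep (K A : ℕ) : Prog :=
  .ite (.natLt 10 7)
    (.ite (.natLt 11 8)
      (.seq (.ofList [.natAdd 12 5 10, .natLoad 12 A 12, .realLoad 1 K 12,
          .natAdd 12 5 11, .natLoad 12 A 12, .realLoad 2 K 12])
        (.ite (.realLe 1 2) (takeItem A 10) (takeItem A 11)))
      (takeItem A 10))
    (takeItem A 11)

/-- Merge the next two blocks of width `w`. -/
def mergeBlock (K A : ℕ) : Prog :=
  .seq (.ofList [.natCopy 10 9, .natAdd 7 9 4])
  (.seq (.ite (.natLt 2 7) (.ofList [.natCopy 7 2]) .skip)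
  (.seq (.ofList [.natCopy 11 7, .natAdd 8 7 4])
  (.seq (.ite (.natLt 2 8) (.ofList [.natCopy 8 2]) .skip)
  (.while (.natLt 9 8) (mergeStep K A)))))

/-- Bottom-up merge sort of the indices below `m` by their keys in the real array `K`. The lists
for the block widths `1, 2, 4, …` are stored one after another in the array `A`. -/
def sortProg (K A : ℕ) : Prog :=
  .seq (.ofList [.natConst 3 1, .natConst 4 1, .natConst 5 0, .natConst 9 0])
  (.seq (.while (.natLt 9 2) (.ofList [.natStore A 9 9, .natAdd 9 9 3]))
  (.while (.natLt 4 2)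
    (.seq (.ofList [.natAdd 6 5 2, .natConst 9 0])
    (.seq (.while (.natLt 9 2) (mergeBlock K A))
    (.ofList [.natCopy 5 6, .natAdd 4 4 4])))))

section

variable {inf sup : ℕ → ℝ} {K A : ℕ} {s : State}

/-- The invariant of the merge loop, started in the state `s`, after `c` steps. -/
structure MergeLoopInv (K A L : ℕ) (s : State) (c : ℕ) (s' : State) : Prop where
  frame : Frame A 9 s s'
  pos : s'.nat 9 = L + c
  le_left : L ≤ s'.nat 10
  left_le : s'.nat 10 ≤ s.nat 7
  le_right : s.nat 7 ≤ s'.nat 11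
  right_le : s'.nat 11 ≤ s.nat 8
  sum : L + c + s.nat 7 = s'.nat 10 + s'.nat 11
  old : ∀ p < s.nat 6 + L, s'.natArr A p = s.natArr A p
  inv : MergeInv (s.realArr K) L (s.nat 7) (s.nat 8) (s'.nat 10) (s'.nat 11)
    fun p => s'.natArr A (s.nat 6 + p)

theorem wp_takeItem {d d' : ℕ} (hd : d = 10 ∧ d' = 11 ∨ d = 11 ∧ d' = 10) (h3 : s.nat 3 = 1) :
    Wp inf sup (takeItem A d) 6 (fun s' => Frame A 9 s s' ∧ s'.nat 9 = s.nat 9 + 1 ∧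
      s'.nat d = s.nat d + 1 ∧ s'.nat d' = s.nat d' ∧
      s'.natArr A = Function.update (s.natArr A) (s.nat 6 + s.nat 9)
        (s.natArr A (s.nat 5 + s.nat d))) s := by
  refine Wp.ofList ?_
  simp only [List.foldl, Instr.step]
  refine ⟨⟨by simp, by simp, ?_, ?_⟩, ?_, ?_, ?_, ?_⟩
  · intro a ha
    simp [State.setNatArr_natArr, ha]
  · intro e he
    have : e ≠ 9 ∧ e ≠ d ∧ e ≠ 12 ∧ e ≠ 13 := by omega
    simp [this]
  all_goals rcases hd with ⟨rfl, rfl⟩ | ⟨rfl, rfl⟩ <;> simp [h3]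

/-- The assumptions on the state in which the merge loop is started. -/
structure MergeLoopPre (K A L : ℕ) (s : State) : Prop where
  one : s.nat 3 = 1
  offset : s.nat 6 = s.nat 5 + s.nat 2
  le_mid : L ≤ s.nat 7
  mid_le : s.nat 7 ≤ s.nat 8
  le_size : s.nat 8 ≤ s.nat 2
  left : SortedOn (s.realArr K) L (s.nat 7) fun p => s.natArr A (s.nat 5 + p)
  right : SortedOn (s.realArr K) (s.nat 7) (s.nat 8) fun p => s.natArr A (s.nat 5 + p)

theorem wp_takeItem_left {L c : ℕ} {s' : State} (hs : MergeLoopPre K A L s)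
    (H : MergeLoopInv K A L s c s') (hi : s'.nat 10 < s.nat 7)
    (hlt : s'.nat 11 < s.nat 8 → KeyLT (s.realArr K) (s.natArr A (s.nat 5 + s'.nat 10))
      (s.natArr A (s.nat 5 + s'.nat 11))) :
    Wp inf sup (takeItem A 10) 6 (MergeLoopInv K A L s (c + 1)) s' := by
  obtain ⟨hone, hoff, hLe, hef, hm, hg, hg'⟩ := hs
  have e3 := H.frame.nat 3 (by norm_num)
  have e5 := H.frame.nat 5 (by norm_num)
  have e6 := H.frame.nat 6 (by norm_num)
  have hold := H.old (s.nat 5 + s'.nat 10) (by omega)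
  obtain ⟨hf, hpos, h1, h2, h3, h4, hs, ho, hinv⟩ := H
  refine (wp_takeItem (Or.inl ⟨rfl, rfl⟩) (e3.trans hone)).mono le_rfl ?_
  rintro t ⟨hft, h9, h10, h11, hA⟩
  refine ⟨hf.trans hft, by omega, by omega, by omega, by omega, by omega, by omega, ?_, ?_⟩
  · intro p hp
    rw [hA, Function.update_of_ne (by omega), ho p hp]
  · rw [h10, h11, hA]
    refine hinv.step_left hLe hef hg hg' h1 hi h3 h4 hlt
      (fun p hp => Function.update_of_ne (by omega) _ _) (fun p hp => ?_)
    rw [show s.nat 6 + p = s'.nat 6 + s'.nat 9 by omega, Function.update_self, e5, hold]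

theorem wp_takeItem_right {L c : ℕ} {s' : State} (hs : MergeLoopPre K A L s)
    (H : MergeLoopInv K A L s c s') (hj : s'.nat 11 < s.nat 8)
    (hlt : s'.nat 10 < s.nat 7 → KeyLT (s.realArr K) (s.natArr A (s.nat 5 + s'.nat 11))
      (s.natArr A (s.nat 5 + s'.nat 10))) :
    Wp inf sup (takeItem A 11) 6 (MergeLoopInv K A L s (c + 1)) s' := by
  obtain ⟨hone, hoff, hLe, hef, hm, hg, hg'⟩ := hs
  have e3 := H.frame.nat 3 (by norm_num)
  have e5 := H.frame.nat 5 (by norm_num)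
  have e6 := H.frame.nat 6 (by norm_num)
  have hold := H.old (s.nat 5 + s'.nat 11) (by omega)
  obtain ⟨hf, hpos, h1, h2, h3, h4, hs, ho, hinv⟩ := H
  refine (wp_takeItem (Or.inr ⟨rfl, rfl⟩) (e3.trans hone)).mono le_rfl ?_
  rintro t ⟨hft, h9, h11, h10, hA⟩
  refine ⟨hf.trans hft, by omega, by omega, by omega, by omega, by omega, by omega, ?_, ?_⟩
  · intro p hp
    rw [hA, Function.update_of_ne (by omega), ho p hp]
  · rw [h10, h11, hA]
    refine hinv.step_right hLe hef hg hg' h1 h2 h3 hj hlt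
      (fun p hp => Function.update_of_ne (by omega) _ _) (fun p hp => ?_)
    rw [show s.nat 6 + p = s'.nat 6 + s'.nat 9 by omega, Function.update_self, e5, hold]

theorem wp_mergeStep {L c : ℕ} {s' : State} (hs : MergeLoopPre K A L s)
    (H : MergeLoopInv K A L s c s') (hc : L + c < s.nat 8) :
    Wp inf sup (mergeStep K A) 15 (MergeLoopInv K A L s (c + 1)) s' := by
  have e2 := H.frame.nat 2 (by norm_num)
  have e5 := H.frame.nat 5 (by norm_num)
  have e7 := H.frame.nat 7 (by norm_num)
  have e8 := H.frame.nat 8 (by norm_num)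
  have hoff := hs.offset
  have hm := hs.le_size
  refine Wp.ite (fun hi => ?_) (fun hi => ?_)
  · change s'.nat 10 < s'.nat 7 at hi
    rw [e7] at hi
    refine Wp.ite (T := 13) (fun hj => ?_) (fun hj => ?_)
    · change s'.nat 11 < s'.nat 8 at hj
      rw [e8] at hj
      refine Wp.seq (T := 6) (T' := 7) (Wp.ofList ?_)
      simp only [List.foldl, Instr.step]
      set s₁ := State.setReal _ 2 _ with hs₁
      have H₁ : MergeLoopInv K A L s c s₁ := by
        obtain ⟨hf, hpos, h1, h2, h3, h4, hsum, ho, hinv⟩ := H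
        refine ⟨hf.trans ⟨by simp [hs₁], by simp [hs₁], by simp [hs₁], fun d hd => ?_⟩, ?_, ?_, ?_,
          ?_, ?_, ?_, ?_, ?_⟩
        · simp [hs₁, show d ≠ 12 by omega]
        all_goals simpa [hs₁]
      have h10 : s₁.nat 10 = s'.nat 10 := by simp [hs₁]
      have h11 : s₁.nat 11 = s'.nat 11 := by simp [hs₁]
      have k1 : s₁.real 1 = s.realArr K (s.natArr A (s.nat 5 + s'.nat 10)) := by
        rw [← H.old (s.nat 5 + s'.nat 10) (by have := hs.le_mid; have := hs.mid_le; omega)]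
        simp [hs₁, e5, H.frame.realArr]
      have k2 : s₁.real 2 = s.realArr K (s.natArr A (s.nat 5 + s'.nat 11)) := by
        rw [← H.old (s.nat 5 + s'.nat 11) (by omega)]
        simp [hs₁, e5, H.frame.realArr]
      -- a tie is won by the left item, since all indices on the left are smaller
      have hidx : s.natArr A (s.nat 5 + s'.nat 10) < s.natArr A (s.nat 5 + s'.nat 11) := by
        have := (hs.left.get H.le_left hi).1
        have := (hs.right.get H.le_right hj).1
        simp only [Finset.mem_Ico] at *
        omega
      refine Wp.ite (T := 6) (fun hb => ?_) (fun hb => ?_)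
      · change s₁.real 1 ≤ s₁.real 2 at hb
        rw [k1, k2] at hb
        refine wp_takeItem_left hs H₁ (by omega) fun _ => ?_
        rw [h10, h11]
        rcases hb.lt_or_eq with hb | hb
        · exact Or.inl hb
        · exact Or.inr ⟨hb, hidx⟩
      · change ¬ s₁.real 1 ≤ s₁.real 2 at hb
        rw [k1, k2, not_le] at hb
        refine wp_takeItem_right hs H₁ (by omega) fun _ => ?_
        rw [h10, h11]
        exact Or.inl hb
    · change ¬ s'.nat 11 < s'.nat 8 at hj
      exact (wp_takeItem_left hs H hi fun h => absurd h (by omega)).mono (by norm_num)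
        fun _ h => h
  · change ¬ s'.nat 10 < s'.nat 7 at hi
    have := H.sum
    have := H.left_le
    exact (wp_takeItem_right hs H (by omega) fun h => absurd h (by omega)).mono (by norm_num)
        fun _ h => h

/-- The merge loop. -/
theorem wp_mergeLoop {L : ℕ} (hs : MergeLoopPre K A L s) (h9 : s.nat 9 = L) (h10 : s.nat 10 = L)
    (h11 : s.nat 11 = s.nat 7) :
    Wp inf sup (.while (.natLt 9 8) (mergeStep K A)) ((s.nat 8 - L) * 16 + 1) (fun s' =>
      Frame A 7 s s' ∧ s'.nat 9 = s.nat 8 ∧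
      (∀ p < s.nat 6 + L, s'.natArr A p = s.natArr A p) ∧
      SortedOn (s.realArr K) L (s.nat 8) fun p => s'.natArr A (s.nat 6 + p)) s := by
  have hle := hs.le_mid
  have hle' := hs.mid_le
  refine (Wp.while_count (MergeLoopInv K A L s) (s.nat 8 - L) 15 ?_ ?_ ?_).mono le_rfl ?_
  · refine ⟨Frame.refl, h9, h10.ge, by omega, by omega, by omega, by omega, fun _ _ => rfl, ?_⟩
    rw [h10, h11]
    exact MergeInv.init
  · intro c s' hc H
    change s'.nat 9 < s'.nat 8 ↔ _
    have := H.frame.nat 8 (by norm_num)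
    have := H.pos
    omega
  · intro c s' hc H
    exact wp_mergeStep hs H (by omega)
  · intro s' H
    have h1 := H.sum
    have h2 := H.left_le
    have h3 := H.right_le
    have h4 := H.pos
    refine ⟨H.frame.mono (by norm_num), by omega, H.old, ?_⟩
    have h := H.inv
    rw [show s'.nat 10 = s.nat 7 by omega, show s'.nat 11 = s.nat 8 by omega] at h
    exact h.sortedOn

theorem wp_clamp {d e : ℕ} :
    Wp inf sup (.ite (.natLt e d) (.ofList [.natCopy d e]) .skip) 2
      (fun s' => s' = s.setNat d (min (s.nat d) (s.nat e))) s := by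
  refine Wp.ite (T := 1) (fun h => Wp.ofList ?_) (fun h => ?_)
  · change s.nat e < s.nat d at h
    simp only [List.foldl, Instr.step, min_eq_right h.le]
  · change ¬ s.nat e < s.nat d at h
    refine (Wp.skip ?_).mono (Nat.zero_le 1) fun _ h => h
    rw [min_eq_left (not_lt.1 h)]
    simp [State.setNat]

theorem wp_mergeBlock (h3 : s.nat 3 = 1) (hoff : s.nat 6 = s.nat 5 + s.nat 2)
    (hL : s.nat 9 ≤ s.nat 2)
    (hleft : SortedOn (s.realArr K) (s.nat 9) (min (s.nat 9 + s.nat 4) (s.nat 2))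
      fun p => s.natArr A (s.nat 5 + p))
    (hright : SortedOn (s.realArr K) (min (s.nat 9 + s.nat 4) (s.nat 2))
      (min (s.nat 9 + 2 * s.nat 4) (s.nat 2)) fun p => s.natArr A (s.nat 5 + p)) :
    Wp inf sup (mergeBlock K A)
      ((min (s.nat 9 + 2 * s.nat 4) (s.nat 2) - s.nat 9) * 16 + 9) (fun s' =>
      Frame A 7 s s' ∧ s'.nat 9 = min (s.nat 9 + 2 * s.nat 4) (s.nat 2) ∧
      (∀ p < s.nat 6 + s.nat 9, s'.natArr A p = s.natArr A p) ∧
      SortedOn (s.realArr K) (s.nat 9) (min (s.nat 9 + 2 * s.nat 4) (s.nat 2))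
        fun p => s'.natArr A (s.nat 6 + p)) s := by
  set f := min (s.nat 9 + 2 * s.nat 4) (s.nat 2) with hf
  refine (Wp.seq (T := 2) (T' := (f - s.nat 9) * 16 + 7) (Wp.ofList ?_)).mono (by omega)
    fun _ h => h
  simp only [List.foldl, Instr.step]
  refine (Wp.seq (T := 2) (T' := (f - s.nat 9) * 16 + 5)
    (wp_clamp.mono le_rfl ?_)).mono (by omega) fun _ h => h
  rintro _ rfl
  refine (Wp.seq (T := 2) (T' := (f - s.nat 9) * 16 + 3) (Wp.ofList ?_)).mono (by omega)
    fun _ h => h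
  simp only [List.foldl, Instr.step]
  refine (Wp.seq (T := 2) (T' := (f - s.nat 9) * 16 + 1)
    (wp_clamp.mono le_rfl ?_)).mono (by omega) fun _ h => h
  rintro _ rfl
  set s₁ := State.setNat _ 8 _ with hs₁
  have hfr : Frame A 7 s s₁ := by
    refine ⟨by simp [hs₁], by simp [hs₁], by simp [hs₁], fun d hd => ?_⟩
    have : d ≠ 7 ∧ d ≠ 8 ∧ d ≠ 10 ∧ d ≠ 11 := by omega
    simp [hs₁, this]
  have hA : s₁.natArr A = s.natArr A := by simp [hs₁]
  have e7 : s₁.nat 7 = min (s.nat 9 + s.nat 4) (s.nat 2) := by simp [hs₁]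
  have e8 : s₁.nat 8 = f := by
    simp [hs₁, hf]
    omega
  have e9 : s₁.nat 9 = s.nat 9 := by simp [hs₁]
  have e10 : s₁.nat 10 = s.nat 9 := by simp [hs₁]
  have e11 : s₁.nat 11 = s₁.nat 7 := by simp [hs₁]
  have e2 := hfr.nat 2 (by norm_num)
  have e3 := hfr.nat 3 (by norm_num)
  have e5 := hfr.nat 5 (by norm_num)
  have e6 := hfr.nat 6 (by norm_num)
  have hpre : MergeLoopPre K A (s.nat 9) s₁ := by
    refine ⟨by omega, by omega, by omega, by omega, by omega, ?_, ?_⟩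
    · rwa [hfr.realArr, e7, hA, e5]
    · rwa [hfr.realArr, e7, e8, hA, e5]
  have := wp_mergeLoop (inf := inf) (sup := sup) hpre e9 e10 e11
  rw [e8, e6, hfr.realArr, hA] at this
  refine this.mono le_rfl ?_
  rintro s' ⟨h1, h2, h3, h4⟩
  exact ⟨hfr.trans h1, h2, h3, h4⟩

/-- Merging all pairs of consecutive blocks. -/
theorem wp_mergePass (h3 : s.nat 3 = 1) (hoff : s.nat 6 = s.nat 5 + s.nat 2)
    (h4 : 0 < s.nat 4) (h9 : s.nat 9 = 0)
    (hg : BlockSorted (s.realArr K) (s.nat 4) (s.nat 2) fun p => s.natArr A (s.nat 5 + p)) :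
    Wp inf sup (.while (.natLt 9 2) (mergeBlock K A)) (s.nat 2 * 26 + 1) (fun s' =>
      Frame A 7 s s' ∧ BlockSorted (s.realArr K) (2 * s.nat 4) (s.nat 2)
        fun p => s'.natArr A (s.nat 6 + p)) s := by
  set m := s.nat 2 with hm
  set w := s.nat 4 with hw
  refine (Wp.while_credit (fun c s' => ∃ q, c = (m - s'.nat 9) * 26 ∧
      s'.nat 9 = min (q * (2 * w)) m ∧ Frame A 7 s s' ∧
      (∀ p < s.nat 6, s'.natArr A p = s.natArr A p) ∧
      ∀ q' < q, SortedOn (s.realArr K) (min (q' * (2 * w)) m) (min ((q' + 1) * (2 * w)) m)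
        fun p => s'.natArr A (s.nat 6 + p))
    (k := m * 26) ⟨0, by simp [h9], by simp [h9], Frame.refl, fun _ _ => rfl, by simp⟩ ?_).mono
    le_rfl ?_
  · rintro _ s₁ ⟨q, rfl, hq, hfr, hold, hout⟩ hb
    change s₁.nat 9 < s₁.nat 2 at hb
    have e2 := hfr.nat 2 (by norm_num)
    have e3 := hfr.nat 3 (by norm_num)
    have e4 := hfr.nat 4 (by norm_num)
    have e5 := hfr.nat 5 (by norm_num)
    have e6 := hfr.nat 6 (by norm_num)
    have hL : s₁.nat 9 = q * (2 * w) := by omega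
    have i1 : q * (2 * w) = 2 * q * w := by ring
    have i2 : q * (2 * w) + w = (2 * q + 1) * w := by ring
    have i3 : q * (2 * w) + 2 * w = (2 * q + 1 + 1) * w := by ring
    have i4 : q * (2 * w) + 2 * w = (q + 1) * (2 * w) := by ring
    have hmin : s₁.nat 9 = min (2 * q * w) m := by omega
    have hsame : ∀ p < m, s₁.natArr A (s.nat 5 + p) = s.natArr A (s.nat 5 + p) :=
      fun p hp => hold _ (by omega)
    have hb1 := (hg (2 * q)).congr (g' := fun p => s₁.natArr A (s.nat 5 + p))
      fun p _ hp => hsame p (by omega)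
    have hb2 := (hg (2 * q + 1)).congr (g' := fun p => s₁.natArr A (s.nat 5 + p))
      fun p _ hp => hsame p (by omega)
    rw [← hmin, ← i2, ← hL] at hb1
    rw [← i2, ← i3, ← hL] at hb2
    have hblock := wp_mergeBlock (inf := inf) (sup := sup) (s := s₁) (K := K) (A := A)
      (by omega) (by omega) hb.le (by rw [hfr.realArr, e5, e2, e4]; exact hb1)
      (by rw [hfr.realArr, e5, e2, e4]; exact hb2)
    rw [e2, e4, e6, hfr.realArr] at hblock
    refine ⟨_, (m - min (s₁.nat 9 + 2 * w) m) * 26, ?_, hblock.mono le_rfl ?_⟩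
    · omega
    · rintro s₂ ⟨hfr₂, h9₂, hold₂, hout₂⟩
      refine ⟨q + 1, by rw [h9₂], ?_, hfr.trans hfr₂, ?_, ?_⟩
      · rw [h9₂, hL, i4]
      · intro p hp
        rw [hold₂ p (by omega), hold p hp]
      · intro q' hq'
        rcases Nat.lt_succ_iff_lt_or_eq.1 hq' with hq' | rfl
        · refine (hout q' hq').congr fun p _ hp => hold₂ _ ?_
          have : (q' + 1) * (2 * w) ≤ q * (2 * w) := Nat.mul_le_mul_right _ hq'
          omega
        · rw [← hq, ← i4, ← hL]
          exact hout₂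
  · rintro s' ⟨⟨_, q, -, hq, hfr, -, hout⟩, hb⟩
    change ¬ s'.nat 9 < s'.nat 2 at hb
    have e2 := hfr.nat 2 (by norm_num)
    refine ⟨hfr, fun q' => ?_⟩
    rcases Nat.lt_or_ge q' q with hq' | hq'
    · exact hout q' hq'
    · apply SortedOn.of_le
      have : q * (2 * w) ≤ q' * (2 * w) := Nat.mul_le_mul_right _ hq'
      omega

/-- The outcome of the sort: its list stands in the array `A` at the offset in register `5`. The
time bound charges a pass of linear cost for each of the `⌈log₂ m⌉` block widths. -/
theorem wp_sortProg :
    Wp inf sup (sortProg K A) (Nat.clog 2 (s.nat 2) * (s.nat 2 * 26 + 7) + s.nat 2 * 3 + 6)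
      (fun s' => Frame A 3 s s' ∧ s'.nat 3 = 1 ∧
        SortedOn (s.realArr K) 0 (s.nat 2) fun p => s'.natArr A (s'.nat 5 + p)) s := by
  set m := s.nat 2 with hm
  refine (Wp.seq (T := 4) (T' := m * 3 + 1 + (Nat.clog 2 m * (m * 26 + 7) + 1))
    (Wp.ofList ?_)).mono (by omega) fun _ h => h
  simp only [List.foldl, Instr.step]
  set s₁ := State.setNat _ 9 _ with hs₁
  have hfr₁ : Frame A 3 s s₁ := by
    refine ⟨by simp [hs₁], by simp [hs₁], by simp [hs₁], fun d hd => ?_⟩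
    have : d ≠ 3 ∧ d ≠ 4 ∧ d ≠ 5 ∧ d ≠ 9 := by omega
    simp [hs₁, this]
  -- the list of the indices in their natural order
  refine Wp.seq ((Wp.while_count (fun k s' => s'.nat 9 = k ∧ Frame A 9 s₁ s' ∧
    ∀ x < k, s'.natArr A x = x) m 2 ⟨by simp [hs₁], Frame.refl, by simp⟩ ?_ ?_).mono le_rfl ?_)
  · rintro k s' hk ⟨h9, hfr, -⟩
    change s'.nat 9 < s'.nat 2 ↔ _
    rw [hfr.nat 2 (by norm_num), hfr₁.nat 2 (by norm_num), h9]
  · rintro k s' hk ⟨h9, hfr, hx⟩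
    refine Wp.ofList ?_
    have h3 : s'.nat 3 = 1 := by rw [hfr.nat 3 (by norm_num)]; simp [hs₁]
    simp only [List.foldl, Instr.step]
    refine ⟨by simp [h3, h9], hfr.trans ⟨by simp, by simp, fun a ha => ?_, fun d hd => ?_⟩, ?_⟩
    · simp [State.setNatArr_natArr, ha]
    · simp [show d ≠ 9 by omega]
    · intro x hxk
      simp only [State.setNat_natArr, State.setNatArr_natArr_self, h9, Function.update_apply]
      split_ifs with h
      · exact h.symm
      · exact hx x (by omega)
  rintro s₂ ⟨-, hfr₂, hid⟩
  have hfr₂ : Frame A 7 s₁ s₂ := hfr₂.mono (by norm_num)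
  have hfr₀ := hfr₁.trans (hfr₂.mono (D' := 3) (by norm_num))
  -- the blocks double their width until one block remains
  refine (Wp.while_credit (fun c s' => ∃ l, c = (Nat.clog 2 m - l) * (m * 26 + 7) ∧
    s'.nat 4 = 2 ^ l ∧ s'.nat 3 = 1 ∧ Frame A 3 s s' ∧
    BlockSorted (s.realArr K) (2 ^ l) m fun p => s'.natArr A (s'.nat 5 + p))
    (k := Nat.clog 2 m * (m * 26 + 7)) ⟨0, rfl, ?_, ?_, hfr₀, ?_⟩ ?_).mono le_rfl ?_
  · rw [hfr₂.nat 4 (by norm_num)]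
    simp [hs₁]
  · rw [hfr₂.nat 3 (by norm_num)]
    simp [hs₁]
  · apply blockSorted_one
    rw [hfr₂.nat 5 (by norm_num)]
    simpa [hs₁] using hid
  · rintro _ t ⟨l, rfl, h4, h3, hfr, hbl⟩ hb
    change t.nat 4 < t.nat 2 at hb
    have e2 : t.nat 2 = m := hfr.nat 2 (by norm_num)
    rw [h4, e2] at hb
    have hl : l < Nat.clog 2 m := (Nat.lt_clog_iff_pow_lt one_lt_two).2 hb
    refine ⟨m * 26 + 6, (Nat.clog 2 m - (l + 1)) * (m * 26 + 7), ?_, ?_⟩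
    · rw [show Nat.clog 2 m - l = Nat.clog 2 m - (l + 1) + 1 by omega, Nat.succ_mul]
      omega
    refine (Wp.seq (T := 2) (T' := m * 26 + 1 + 2) (Wp.ofList ?_)).mono (by omega) fun _ h => h
    simp only [List.foldl, Instr.step]
    set t₁ := State.setNat _ 9 _ with ht₁
    have hft₁ : Frame A 6 t t₁ := by
      refine ⟨by simp [ht₁], by simp [ht₁], by simp [ht₁], fun d hd => ?_⟩
      have : d ≠ 6 ∧ d ≠ 9 := by omega
      simp [ht₁, this]
    have f2 := hft₁.nat 2 (by norm_num)
    have f3 := hft₁.nat 3 (by norm_num)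
    have f4 := hft₁.nat 4 (by norm_num)
    have f5 := hft₁.nat 5 (by norm_num)
    have fA : t₁.natArr A = t.natArr A := by simp [ht₁]
    have hpass := wp_mergePass (inf := inf) (sup := sup) (s := t₁) (K := K) (A := A) (by omega)
      (by simp [ht₁]) (by rw [f4, h4]; positivity) (by simp [ht₁])
      (by rw [hft₁.realArr, hfr.realArr, f4, f2, f5, fA, h4, e2]; exact hbl)
    rw [f2, e2] at hpass
    refine Wp.seq (hpass.mono le_rfl ?_)
    rintro t₂ ⟨hft₂, hbl₂⟩
    have g3 := hft₂.nat 3 (by norm_num)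
    have g4 := hft₂.nat 4 (by norm_num)
    have g6 := hft₂.nat 6 (by norm_num)
    refine Wp.ofList ?_
    simp only [List.foldl, Instr.step]
    refine ⟨l + 1, rfl, ?_, ?_, ?_, ?_⟩
    · simp [g4, f4, h4, pow_succ, mul_two]
    · simp [g3, f3, h3]
    · refine (hfr.trans (hft₁.mono (by norm_num))).trans
        ((hft₂.mono (D' := 3) (by norm_num)).trans ?_)
      refine ⟨by simp, by simp, by simp, fun d hd => ?_⟩
      have : d ≠ 4 ∧ d ≠ 5 := by omega
      simp [this]
    · rw [hft₁.realArr, hfr.realArr, f4, h4, ← pow_succ'] at hbl₂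
      simpa [g6] using hbl₂
  · rintro t ⟨⟨_, l, -, h4, h3, hfr, hbl⟩, hb⟩
    change ¬ t.nat 4 < t.nat 2 at hb
    rw [h4, hfr.nat 2 (by norm_num), not_lt] at hb
    exact ⟨hfr, h3, hbl.sortedOn hb⟩

end

end RealRAM

/-! ### Greedy layers -/

/-- The state of the greedy partition of the points with the coordinates `key x`, for `x < n`, into
zones of width `d`, after the first `k` points in the order of the coordinates have been put into
the zones `0, …, l`: the zone `i` starts at `σ i` and the last zone ends at `lim`. -/
structure ZoneInv (key : ℕ → ℝ) (n : ℕ) (d : ℝ) (k l : ℕ) (lim : ℝ) (σ : ℕ → ℝ) (lay : ℕ → ℕ) :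
    Prop where
  lim_eq : lim = σ l + d
  start_nonneg : ∀ i ≤ l, 0 ≤ σ i
  start_lt : ∀ i < l, σ i + d < σ (i + 1)
  le : ∀ x < n, keyRank key (Finset.Ico 0 n) x < k → lay x ≤ l
  zone : ∀ x < n, keyRank key (Finset.Ico 0 n) x < k →
    σ (lay x) ≤ key x ∧ key x ≤ σ (lay x) + d
  rest : ∀ x < n, k ≤ keyRank key (Finset.Ico 0 n) x → σ l ≤ key x

namespace ZoneInv

variable {key : ℕ → ℝ} {n k l x : ℕ} {d lim : ℝ} {σ : ℕ → ℝ} {lay : ℕ → ℕ}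

/-- The next point `x` belongs to the current zone. -/
theorem stay (H : ZoneInv key n d k l lim σ lay) (hx : x < n)
    (hk : keyRank key (Finset.Ico 0 n) x = k) (hle : key x ≤ lim) :
    ZoneInv key n d (k + 1) l lim σ (Function.update lay x l) := by
  have hne : ∀ y < n, keyRank key (Finset.Ico 0 n) y < k + 1 → y ≠ x →
      keyRank key (Finset.Ico 0 n) y < k := fun y hy hyk hyx => by
    by_contra h
    exact hyx (keyRank_inj (key := key) (S := Finset.Ico 0 n) (by simpa) (by simpa) (by omega))
  refine ⟨H.lim_eq, H.start_nonneg, H.start_lt, fun y hy hyk => ?_, fun y hy hyk => ?_,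
    fun y hy hyk => H.rest y hy (by omega)⟩
  · rcases eq_or_ne y x with rfl | hyx
    · simp
    · rw [Function.update_of_ne hyx]
      exact H.le y hy (hne y hy hyk hyx)
  · rcases eq_or_ne y x with rfl | hyx
    · rw [Function.update_self]
      exact ⟨H.rest y hy hk.ge, hle.trans H.lim_eq.le⟩
    · rw [Function.update_of_ne hyx]
      exact H.zone y hy (hne y hy hyk hyx)

/-- The next point `x` lies beyond the current zone and starts a new one. -/
theorem start (H : ZoneInv key n d k l lim σ lay) (hd : 0 ≤ d)
    (hk : keyRank key (Finset.Ico 0 n) x = k) (hlt : lim < key x) :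
    ZoneInv key n d k (l + 1) (key x + d) (Function.update σ (l + 1) (key x)) lay := by
  have hl := H.lim_eq
  have h0 := H.start_nonneg l le_rfl
  refine ⟨by simp, fun i hi => ?_, fun i hi => ?_, fun y hy hyk => (H.le y hy hyk).trans
    (Nat.le_succ l), fun y hy hyk => ?_, fun y hy hyk => ?_⟩
  · rcases Nat.le_succ_iff.1 hi with hi | rfl
    · rw [Function.update_of_ne (by omega)]
      exact H.start_nonneg i hi
    · rw [Function.update_self]
      linarith
  · rw [Function.update_of_ne (by omega)]
    rcases Nat.lt_succ_iff_lt_or_eq.1 hi with hi | rfl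
    · rw [Function.update_of_ne (by omega)]
      exact H.start_lt i hi
    · rw [Function.update_self]
      linarith
  · rw [Function.update_of_ne (by have := H.le y hy hyk; omega)]
    exact H.zone y hy hyk
  · rw [Function.update_self]
    by_contra! hlt
    have := keyRank_lt (S := Finset.Ico 0 n) (by simpa using hy) (Or.inl hlt)
    omega

theorem start_mono (H : ZoneInv key n d k l lim σ lay) (hd : 0 ≤ d) {i j : ℕ} (hij : i ≤ j)
    (hj : j ≤ l) : σ i ≤ σ j := by
  induction j, hij using Nat.le_induction with
  | base => exact le_rfl
  | succ j _ ih => linarith [ih (by omega), H.start_lt j (by omega)]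

theorem lt_of_lay (H : ZoneInv key n d k l lim σ lay) (hd : 0 ≤ d) {x y : ℕ} (hx : x < n)
    (hy : y < n) (hxk : keyRank key (Finset.Ico 0 n) x < k)
    (hyk : keyRank key (Finset.Ico 0 n) y < k) (h : lay x + 1 < lay y) :
    key x + d < key y := by
  have h1 := H.le y hy hyk
  have h2 := H.start_lt (lay x) (by omega)
  have h3 := H.start_lt (lay x + 1) (by omega)
  have h4 := H.start_mono hd (i := lay x + 1 + 1) h h1
  linarith [(H.zone x hx hxk).2, (H.zone y hy hyk).1]

theorem exists_zone (H : ZoneInv key n d k l lim σ lay)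
    (hk : ∀ x < n, keyRank key (Finset.Ico 0 n) x < k) (i : ℕ) :
    ∃ a, 0 ≤ a ∧ ∀ x < n, lay x = i → a ≤ key x ∧ key x ≤ a + d := by
  rcases Nat.lt_or_ge l i with hi | hi
  · refine ⟨0, le_rfl, fun x hx hxi => ?_⟩
    have := H.le x hx (hk x hx)
    omega
  · refine ⟨σ i, H.start_nonneg i hi, fun x hx hxi => ?_⟩
    subst hxi
    exact H.zone x hx (hk x hx)

end ZoneInv

/-! ### The algorithm for spherical uniform disk graphs -/

namespace RealRAM

/-- Write the infima and the suprema of the polar angles to the real array `2`, at the indices `v`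
and `n + v`, and store the numbers `2n` and `1` in the registers `2` and `3`. -/
def endpointsProg : Prog :=
  .seq (.ofList [.natAdd 2 0 0, .natConst 3 1, .natConst 4 0])
  (.while (.natLt 4 0) (.ofList [.askInf 1 4, .realStore 2 4 1, .askSup 1 4, .natAdd 5 4 0,
    .realStore 2 5 1, .natAdd 4 4 3]))

/-- Write the positions of the endpoints in their sorted list to the arrays `0` and `1`. -/
def positionsProg : Prog :=
  .seq (.ofList [.natConst 9 0])
  (.while (.natLt 9 2)
    (.seq (.ofList [.natAdd 12 5 9, .natLoad 12 3 12])
    (.seq (.ite (.natLt 12 0) (.ofList [.natStore 0 12 9])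
      (.ofList [.natSub 12 12 0, .natStore 1 12 9]))
    (.ofList [.natAdd 9 9 3]))))

/-- Write the indices of the layers to the array `2`. The current layer is in the natural register
`6`, the upper end of its zone in the real register `1`, and `2r` in the real register `3`. -/
def layersProg : Prog :=
  .seq (.ofList [.natConst 9 0, .natConst 6 0, .natLoad 12 3 5, .realLoad 1 0 12, .realAdd 3 0 0,
    .realAdd 1 1 3])
  (.while (.natLt 9 2)
    (.seq (.ofList [.natAdd 12 5 9, .natLoad 12 3 12, .realLoad 2 0 12])
    (.seq (.ite (.realLt 1 2) (.ofList [.natAdd 6 6 3, .realAdd 1 2 3]) .skip)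
    (.ofList [.natStore 2 12 6, .natAdd 9 9 3]))))

/-- The whole algorithm: a path decomposition from the sorted list of the `2n` endpoints of the
intervals of polar angles, a layering from the sorted list of the colatitudes. -/
def decompositionProg : Prog :=
  .seq endpointsProg
  (.seq (sortProg 2 3)
  (.seq positionsProg
  (.seq (.ofList [.natCopy 2 0])
  (.seq (sortProg 0 3)
  (.seq layersProg
  (.ofList [.natAdd 1 0 0]))))))

variable {inf sup : ℕ → ℝ} {s : State}

theorem wp_endpointsProg :
    Wp inf sup endpointsProg (s.nat 0 * 7 + 4) (fun s' => s'.nat 0 = s.nat 0 ∧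
      s'.nat 2 = s.nat 0 + s.nat 0 ∧ s'.real 0 = s.real 0 ∧ s'.realArr 0 = s.realArr 0 ∧
      ∀ i < s.nat 0, s'.realArr 2 i = inf i ∧ s'.realArr 2 (s.nat 0 + i) = sup i) s := by
  set n := s.nat 0 with hn
  refine (Wp.seq (T := 3) (T' := n * 7 + 1) (Wp.ofList ?_)).mono (by omega) fun _ h => h
  simp only [List.foldl, Instr.step]
  refine (Wp.while_count (fun k s' => s'.nat 0 = n ∧ s'.nat 2 = n + n ∧ s'.nat 3 = 1 ∧
    s'.nat 4 = k ∧ s'.real 0 = s.real 0 ∧ s'.realArr 0 = s.realArr 0 ∧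
    ∀ i < k, s'.realArr 2 i = inf i ∧ s'.realArr 2 (n + i) = sup i) n 6 ?_ ?_ ?_).mono le_rfl ?_
  · simp [hn]
  · rintro k s' hk ⟨h0, -, -, h4, -⟩
    change s'.nat 4 < s'.nat 0 ↔ _
    rw [h4, h0]
  · rintro k s' hk ⟨h0, h2, h3, h4, hr, hr0, h⟩
    refine Wp.ofList ?_
    simp only [List.foldl, Instr.step]
    refine ⟨by simp [h0], by simp [h2], by simp [h3], by simp [h3, h4], by simp [hr],
      by simp [hr0], fun i hi => ?_⟩
    rcases Nat.lt_succ_iff_lt_or_eq.1 hi with hi | rfl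
    · simpa [Function.update_apply, h0, h4, show i ≠ k + n by omega, show i ≠ k by omega,
        show n + i ≠ k + n by omega, show n + i ≠ k by omega] using h i hi
    · simp [h0, h4, show n ≠ 0 by omega, Nat.add_comm n i]
  · rintro s' ⟨h0, h2, -, -, hr, hr0, h⟩
    exact ⟨h0, h2, hr, hr0, h⟩

theorem wp_positionsProg {key : ℕ → ℝ} (h3 : s.nat 3 = 1) (h2 : s.nat 2 = s.nat 0 + s.nat 0)
    (hg : SortedOn key 0 (s.nat 0 + s.nat 0) fun p => s.natArr 3 (s.nat 5 + p)) :
    Wp inf sup positionsProg (s.nat 0 * 14 + 2) (fun s' => s'.nat 0 = s.nat 0 ∧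
      s'.real 0 = s.real 0 ∧ s'.realArr = s.realArr ∧ ∀ v < s.nat 0,
        s'.natArr 0 v = keyRank key (Finset.Ico 0 (s.nat 0 + s.nat 0)) v ∧
        s'.natArr 1 v = keyRank key (Finset.Ico 0 (s.nat 0 + s.nat 0)) (s.nat 0 + v)) s := by
  set n := s.nat 0 with hn
  set S := Finset.Ico 0 (n + n) with hS
  refine (Wp.seq (T := 1) (T' := (n + n) * 7 + 1) (Wp.ofList ?_)).mono (by omega) fun _ h => h
  simp only [List.foldl, Instr.step]
  refine (Wp.while_count (fun k s' => s'.nat 0 = n ∧ s'.nat 2 = n + n ∧ s'.nat 3 = 1 ∧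
    s'.nat 5 = s.nat 5 ∧ s'.nat 9 = k ∧ s'.real 0 = s.real 0 ∧ s'.realArr = s.realArr ∧
    s'.natArr 3 = s.natArr 3 ∧ ∀ v < n, (keyRank key S v < k → s'.natArr 0 v = keyRank key S v) ∧
      (keyRank key S (n + v) < k → s'.natArr 1 v = keyRank key S (n + v)))
    (n + n) 6 ?_ ?_ ?_).mono le_rfl ?_
  · simp [hn, h3, h2]
  · rintro k s' hk ⟨-, h2, -, -, h9, -⟩
    change s'.nat 9 < s'.nat 2 ↔ _
    rw [h9, h2]
  · rintro k s' hk ⟨h0, h2, h3, h5, h9, hr, hra, hA, h⟩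
    refine Wp.seq (T := 2) (T' := 4) (Wp.ofList ?_)
    simp only [List.foldl, Instr.step, State.setNat_setNat, State.setNat_nat, State.setNat_natArr,
      ↓reduceIte, h5, h9, hA]
    -- `x` is the endpoint at position `k`
    obtain ⟨hxS, hxk⟩ := hg.get (Nat.zero_le k) hk
    set x := s.natArr 3 (s.nat 5 + k) with hx
    rw [Nat.zero_add, ← hS] at hxk
    have hxS' : x < n + n := by simpa [hS] using hxS
    have huniq : ∀ y < n + n, keyRank key S y < k + 1 → y ≠ x → keyRank key S y < k :=
      fun y hy hyk hyx => by
        by_contra hlt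
        have : keyRank key S y = keyRank key S x := by omega
        exact hyx (keyRank_inj (by simp [hy]) hxS this)
    refine Wp.seq (T := 3) (T' := 1) (Wp.ite (T := 2) (fun hb => ?_) (fun hb => ?_))
    · have hxn : x < n := by simpa [Test.Holds, h0] using hb
      refine (Wp.ofList ?_).mono (T := 1) (by norm_num) fun _ h => h
      refine Wp.ofList ?_
      simp only [List.foldl, Instr.step]
      refine ⟨by simp [h0], by simp [h2], by simp [h3], by simp [h5],
        by simp [h9, h3], by simp [hr], by simp [hra],
        by simp [hA, State.setNatArr_natArr], fun v hv => ⟨fun hvk => ?_, fun hvk => ?_⟩⟩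
      · rcases eq_or_ne v x with rfl | hvx
        · simpa [h9] using hxk.symm
        · simpa [hvx] using (h v hv).1 (huniq v (by omega) hvk hvx)
      · simpa [State.setNatArr_natArr] using
          (h v hv).2 (huniq (n + v) (by omega) hvk (by omega))
    · have hxn : n ≤ x := by simpa [Test.Holds, h0] using hb
      refine (Wp.ofList ?_).mono (T := 2) (by norm_num) fun _ h => h
      refine Wp.ofList ?_
      simp only [List.foldl, Instr.step]
      refine ⟨by simp [h0], by simp [h2], by simp [h3], by simp [h5],
        by simp [h9, h3], by simp [hr], by simp [hra],
        by simp [hA, State.setNatArr_natArr], fun v hv => ⟨fun hvk => ?_, fun hvk => ?_⟩⟩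
      · simpa [State.setNatArr_natArr] using
          (h v hv).1 (huniq v (by omega) hvk (by omega))
      · rcases eq_or_ne (n + v) x with hvx | hvx
        · rw [hvx, hxk, show v = x - n by omega]
          simp [h9, h0]
        · have : v ≠ x - n := by omega
          simpa [h0, this] using (h v hv).2 (huniq (n + v) (by omega) hvk hvx)
  · rintro s' ⟨h0, -, -, -, -, hr, hra, -, h⟩
    refine ⟨h0, hr, hra, fun v hv => ⟨(h v hv).1 ?_, (h v hv).2 ?_⟩⟩
    · simpa [hS] using keyRank_lt_card (key := key) (S := S) (x := v) (by simp [hS]; omega)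
    · simpa [hS] using keyRank_lt_card (key := key) (S := S) (x := n + v) (by simp [hS]; omega)

theorem wp_layersProg {n : ℕ} (hn : 0 < n) (h3 : s.nat 3 = 1) (h2 : s.nat 2 = n)
    (hr : 0 ≤ s.real 0) (hkey : ∀ x < n, 0 ≤ s.realArr 0 x)
    (hg : SortedOn (s.realArr 0) 0 n fun p => s.natArr 3 (s.nat 5 + p)) :
    Wp inf sup layersProg (n * 9 + 7) (fun s' => s'.nat 0 = s.nat 0 ∧
      (∀ a < 2, s'.natArr a = s.natArr a) ∧
      ∃ l lim σ, ZoneInv (s.realArr 0) n (s.real 0 + s.real 0) n l lim σ (s'.natArr 2)) s := by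
  set key := s.realArr 0 with hkeydef
  set d := s.real 0 + s.real 0 with hd
  have hd0 : 0 ≤ d := by linarith
  refine (Wp.seq (T := 6) (T' := n * 9 + 1) (Wp.ofList ?_)).mono (by omega) fun _ h => h
  simp only [List.foldl, Instr.step]
  refine (Wp.while_count (fun k s' => s'.nat 0 = s.nat 0 ∧ s'.nat 2 = n ∧ s'.nat 3 = 1 ∧
    s'.nat 5 = s.nat 5 ∧ s'.nat 9 = k ∧ s'.real 3 = d ∧ s'.realArr 0 = key ∧
    s'.natArr 3 = s.natArr 3 ∧ (∀ a < 2, s'.natArr a = s.natArr a) ∧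
    ∃ σ, ZoneInv key n d k (s'.nat 6) (s'.real 1) σ (s'.natArr 2)) n 8 ?_ ?_ ?_).mono le_rfl ?_
  · refine ⟨by simp, by simp [h2], by simp [h3], by simp, by simp, by simp [hd],
      by simp [hkeydef], by simp, by simp, fun _ => key (s.natArr 3 (s.nat 5)), ?_⟩
    obtain ⟨hxS, hxk⟩ := hg.get le_rfl hn
    simp only [add_zero, zero_add] at hxS hxk
    refine ⟨by simp [hkeydef, hd], fun _ _ => hkey _ (by simpa using hxS), by simp, by simp,
      by simp, fun y hy _ => ?_⟩
    rcases eq_or_ne (s.natArr 3 (s.nat 5)) y with h | h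
    · rw [h]
    · refine ((KeyLT.total h).resolve_right fun hlt => ?_).key_le
      have := keyRank_lt (S := Finset.Ico 0 n) (by simpa using hy) hlt
      omega
  · rintro k s' hk ⟨-, h2, -, -, h9, -⟩
    change s'.nat 9 < s'.nat 2 ↔ _
    rw [h9, h2]
  · rintro k s' hk ⟨h0, h2, h3, h5, h9, hd3, hr0, hA, hA2, σ, hZ⟩
    refine Wp.seq (T := 3) (T' := 5) (Wp.ofList ?_)
    simp only [List.foldl, Instr.step, State.setNat_setNat, State.setNat_nat, State.setNat_natArr,
      State.setNat_realArr, ↓reduceIte, h5, h9, hA, hr0]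
    -- `x` is the point at position `k`
    obtain ⟨hxS, hxk⟩ := hg.get (Nat.zero_le k) hk
    set x := s.natArr 3 (s.nat 5 + k) with hx
    rw [Nat.zero_add] at hxk
    have hxn : x < n := by simpa using hxS
    refine Wp.seq (T := 3) (T' := 2) (Wp.ite (T := 2) (fun hb => ?_) (fun hb => ?_))
    · have hb : s'.real 1 < key x := by simpa [Test.Holds] using hb
      refine Wp.ofList ?_
      simp only [List.foldl, Instr.step]
      refine Wp.ofList ?_
      simp only [List.foldl, Instr.step]
      refine ⟨by simp [h0], by simp [h2], by simp [h3], by simp [h5],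
        by simp [h9, h3], by simp [hd3], by simp [hr0],
        by simp [hA, State.setNatArr_natArr], fun a ha => ?_,
        Function.update σ (s'.nat 6 + 1) (key x), ?_⟩
      · simpa [State.setNatArr_natArr, show a ≠ 2 by omega] using hA2 a ha
      · have := (hZ.start hd0 hxk hb).stay hxn hxk (by linarith)
        simpa [h3, hd3] using this
    · have hb : key x ≤ s'.real 1 := by simpa [Test.Holds] using hb
      refine (Wp.skip ?_).mono (Nat.zero_le 2) fun _ h => h
      refine Wp.ofList ?_
      simp only [List.foldl, Instr.step]
      refine ⟨by simp [h0], by simp [h2], by simp [h3], by simp [h5],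
        by simp [h9, h3], by simp [hd3], by simp [hr0],
        by simp [hA, State.setNatArr_natArr], fun a ha => ?_, σ, ?_⟩
      · simpa [State.setNatArr_natArr, show a ≠ 2 by omega] using hA2 a ha
      · have := hZ.stay hxn hxk hb
        simpa using this
  · rintro s' ⟨h0, -, -, -, -, -, -, -, hA2, σ, hZ⟩
    exact ⟨h0, hA2, _, _, σ, hZ⟩

end RealRAM

/-! ### Correctness and running time -/

namespace RealRAM

/-- The outcome of the whole algorithm: the arrays `0` and `1` hold the ranks of the endpoints of
the intervals of polar angles, the array `2` holds the layers. -/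
theorem wp_decompositionProg {inf sup : ℕ → ℝ} {s : State} {n : ℕ} (hn : 0 < n)
    (h0 : s.nat 0 = n) (hr : 0 ≤ s.real 0) (hb : ∀ x < n, 0 ≤ s.realArr 0 x) :
    Wp inf sup decompositionProg (Nat.clog 2 (n + n) * (n * 78 + 14) + n * 39 + 27) (fun s' =>
      s'.nat 1 = n + n ∧
      (∃ key : ℕ → ℝ, (∀ i < n, key i = inf i ∧ key (n + i) = sup i) ∧ ∀ v < n,
        s'.natArr 0 v = keyRank key (Finset.Ico 0 (n + n)) v ∧
        s'.natArr 1 v = keyRank key (Finset.Ico 0 (n + n)) (n + v)) ∧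
      ∃ l lim σ, ZoneInv (s.realArr 0) n (s.real 0 + s.real 0) n l lim σ (s'.natArr 2)) s := by
  subst h0
  set n := s.nat 0 with hn'
  have hT : Nat.clog 2 n * (n * 26 + 7) ≤ Nat.clog 2 (n + n) * (n * 26 + 7) :=
    Nat.mul_le_mul_right _ (Nat.clog_mono_right 2 (by omega))
  refine Wp.mono (T := (n * 7 + 4) + ((Nat.clog 2 (n + n) * ((n + n) * 26 + 7) + (n + n) * 3 + 6)
    + ((n * 14 + 2) + (1 + ((Nat.clog 2 n * (n * 26 + 7) + n * 3 + 6) + ((n * 9 + 7) + 1))))))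
    ?_ (by nlinarith) fun _ h => h
  refine Wp.seq (wp_endpointsProg.mono le_rfl ?_)
  rintro s₁ ⟨a0, a2, ar, ara, hkey⟩
  refine Wp.seq (wp_sortProg.mono (by rw [a2]) ?_)
  rintro s₂ ⟨b, b3, bsort⟩
  rw [a2] at bsort
  have b0 : s₂.nat 0 = n := (b.nat 0 (by norm_num)).trans a0
  have b2 : s₂.nat 2 = n + n := (b.nat 2 (by norm_num)).trans a2
  refine Wp.seq ((wp_positionsProg b3 (by rw [b0, b2]) (by rw [b0]; exact bsort)).mono
    (by rw [b0]) ?_)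
  rintro s₃ ⟨c0, cr, cra, hpos⟩
  rw [b0] at c0 hpos
  refine Wp.seq (T := 1) (Wp.ofList ?_)
  simp only [List.foldl, Instr.step]
  set s₄ := State.setNat _ 2 _ with hs₄
  have d0 : s₄.nat 0 = n := by simp [hs₄, c0]
  have d2 : s₄.nat 2 = n := by simp [hs₄, c0]
  have dr : s₄.real 0 = s.real 0 := by
    simp only [hs₄, State.setNat_real]
    rw [cr, b.real, ar]
  have dra : s₄.realArr 0 = s.realArr 0 := by
    simp only [hs₄, State.setNat_realArr]
    rw [cra, b.realArr, ara]
  refine Wp.seq (wp_sortProg.mono (by rw [d2]) ?_)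
  rintro s₅ ⟨e, e3, esort⟩
  have e0 : s₅.nat 0 = n := (e.nat 0 (by norm_num)).trans d0
  have e2 : s₅.nat 2 = n := (e.nat 2 (by norm_num)).trans d2
  have er : s₅.real 0 = s.real 0 := e.real.trans dr
  have era : s₅.realArr 0 = s.realArr 0 := by rw [e.realArr, dra]
  rw [d2, dra, ← era] at esort
  refine Wp.seq ((wp_layersProg hn e3 e2 (by rwa [er]) (by rwa [era]) esort).mono le_rfl ?_)
  rintro s₆ ⟨f0, fA, fZ⟩
  rw [er, era] at fZ
  refine Wp.ofList ?_
  simp only [List.foldl, Instr.step]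
  refine ⟨by simp [f0, e0], ⟨_, hkey, fun v hv => ?_⟩, by simpa using fZ⟩
  simp only [State.setNat_natArr]
  rw [fA 0 (by norm_num), fA 1 (by norm_num), e.natArr 0 (by norm_num), e.natArr 1 (by norm_num)]
  exact hpos v hv

end RealRAM

theorem clog_two_le_log {n : ℕ} (hn : 0 < n) :
    (Nat.clog 2 (n + n) : ℝ) ≤ 6 * Real.log (n + 1) := by
  have hpow := Nat.pow_pred_clog_lt_self one_lt_two (x := n + n) (by omega)
  have hpos : 0 < Nat.clog 2 (n + n) := Nat.clog_pos one_lt_two (by omega)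
  obtain ⟨k, hk⟩ : ∃ k, Nat.clog 2 (n + n) = k + 1 := ⟨_, (Nat.succ_pred_eq_of_pos hpos).symm⟩
  rw [hk] at hpow ⊢
  have hn1 : (1 : ℝ) ≤ n := by exact_mod_cast hn
  have h1 : (2 : ℝ) ^ k ≤ 2 * (n + 1) := by
    have : ((2 ^ k : ℕ) : ℝ) ≤ ((n + n : ℕ) : ℝ) := by exact_mod_cast hpow.le
    push_cast at this
    linarith
  have h2 := Real.log_le_log (by positivity) h1
  rw [Real.log_pow, Real.log_mul (by norm_num) (by positivity)] at h2
  have h3 : Real.log 2 ≤ Real.log (n + 1) := Real.log_le_log (by norm_num) (by linarith)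
  have h4 := Real.log_two_gt_d9
  push_cast
  nlinarith [(Nat.cast_nonneg k : (0 : ℝ) ≤ k)]

theorem decompositionProg_time_le {n t : ℕ} (hn : 0 < n)
    (ht : t ≤ Nat.clog 2 (n + n) * (n * 78 + 14) + n * 39 + 27) :
    (t : ℝ) ≤ 684 * (n * Real.log (n + 1)) := by
  have hn1 : (1 : ℝ) ≤ n := by exact_mod_cast hn
  have h1 := clog_two_le_log hn
  have h2 : 1 ≤ 2 * Real.log ((n : ℝ) + 1) := by
    have h3 : Real.log 2 ≤ Real.log (n + 1) := Real.log_le_log (by norm_num) (by linarith)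
    have h4 := Real.log_two_gt_d9
    linarith
  have ht' : (t : ℝ) ≤ Nat.clog 2 (n + n) * (n * 78 + 14) + n * 39 + 27 := by exact_mod_cast ht
  calc (t : ℝ) ≤ Nat.clog 2 (n + n) * (n * 78 + 14) + n * 39 + 27 := ht'
    _ ≤ 6 * Real.log (n + 1) * (n * 78 + n * 14) + (n * 39 + n * 27) * (2 * Real.log (n + 1)) := by
        have : (n : ℝ) * 39 + 27 ≤ (n * 39 + n * 27) * (2 * Real.log (n + 1)) := by nlinarith
        have : (Nat.clog 2 (n + n) : ℝ) * (n * 78 + 14)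
            ≤ 6 * Real.log (n + 1) * (n * 78 + n * 14) := by
          apply mul_le_mul h1 (by linarith) (by positivity) (by linarith)
        linarith
    _ = 684 * (n * Real.log (n + 1)) := by ring

/-- The output of the algorithm represents a path decomposition and a layering of small layered
independence number. -/
theorem DiskInstance.exists_runs {n : ℕ} (I : DiskInstance n) (hn : 0 < n) :
    ∃ (t : ℕ) (s : RealRAM.State), I.Runs RealRAM.decompositionProg t s ∧
      (t : ℝ) ≤ 684 * (n * Real.log (n + 1)) ∧
      ∃ (𝒯 : TreeDecomposition I.graph) (L : Layering I.graph),
        s.Represents 𝒯 L ∧ 𝒯.size ≤ 2 * n ∧ 𝒯.Witnesses L 30 := by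
  have hb : ∀ x (hx : x < n), I.initState.realArr 0 x = I.b ⟨x, hx⟩ := fun x hx => by
    simp [initState, hx]
  have hr : I.initState.real 0 = I.r := by simp [initState]
  obtain ⟨t, s, hexec, ht, h1, ⟨key, hkey, hpos⟩, l, lim, σ, hZ⟩ :=
    RealRAM.wp_decompositionProg (inf := I.angleInf) (sup := I.angleSup) (s := I.initState) hn
      (by simp [initState]) (by rw [hr]; exact I.r_pos.le)
      (fun x hx => by rw [hb x hx]; exact (I.b_mem _).1)
  refine ⟨t, s, hexec, decompositionProg_time_le hn ht, ?_⟩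
  set S := Finset.Ico 0 (n + n) with hS
  have hrank : ∀ x < n, keyRank (I.initState.realArr 0) (Finset.Ico 0 n) x < n := fun x hx => by
    simpa using keyRank_lt_card (key := I.initState.realArr 0) (S := Finset.Ico 0 n) (x := x)
      (by simpa using hx)
  have hd : 0 ≤ I.initState.real 0 + I.initState.real 0 := by rw [hr]; linarith [I.r_pos]
  have hmem : ∀ x < n + n, x ∈ S := fun x hx => by simp [hS, hx]
  have key_le : ∀ {x y}, x < n + n → y < n + n → keyRank key S x ≤ keyRank key S y →
      key x ≤ key y := fun {x y} hx hy h => by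
    rcases h.lt_or_eq with h | h
    · exact ((keyRank_lt_iff (hmem x hx) (hmem y hy)).1 h).key_le
    · rw [keyRank_inj (hmem x hx) (hmem y hy) h]
  have hhi : ∀ v : Fin n, s.natArr 1 v < n + n := fun v => by
    have := keyRank_lt_card (key := key) (hmem (n + v) (by omega))
    simpa [(hpos v v.2).2, hS] using this
  have hlohi : ∀ u v : Fin n, I.angleInf u ≤ I.angleSup v → s.natArr 0 u ≤ s.natArr 1 v := by
    intro u v huv
    simp only [(hpos u u.2).1, (hpos v v.2).2]
    -- ties between lower and upper endpoints are broken in favour of the lower ones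
    refine keyRank_le ?_
    rw [KeyLT, (hkey u u.2).1, (hkey v v.2).2]
    rcases huv.lt_or_eq with h | h
    · exact Or.inl h
    · exact Or.inr ⟨h, by omega⟩
  have hangle : ∀ t < n + n, ∃ α, ∀ v : Fin n, s.natArr 0 v ≤ t → t ≤ s.natArr 1 v →
      I.angleInf v ≤ α ∧ α ≤ I.angleSup v := by
    intro t ht
    -- the angle of the node `t` is the endpoint at position `t`
    obtain ⟨x, hx, hxt⟩ := exists_keyRank_eq (key := key) (S := S) (k := t) (by simpa [hS] using ht)
    have hx' : x < n + n := by simpa [hS] using hx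
    refine ⟨key x, fun v hlo hhi => ?_⟩
    rw [(hpos v v.2).1] at hlo
    rw [(hpos v v.2).2] at hhi
    rw [← (hkey v v.2).1, ← (hkey v v.2).2]
    exact ⟨key_le (by omega) hx' (by omega), key_le hx' (by omega) (by omega)⟩
  have hfar : ∀ u v : Fin n, s.natArr 2 v + 1 < s.natArr 2 u → I.b v + 2 * I.r < I.b u := by
    intro u v h
    have := hZ.lt_of_lay hd v.2 u.2 (hrank v v.2) (hrank u u.2) h
    rw [hb v v.2, hb u u.2, hr] at this
    linarith
  have hzone : ∀ i, ∃ a, 0 ≤ a ∧ ∀ v : Fin n, s.natArr 2 v = i →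
      a ≤ I.b v ∧ I.b v ≤ a + 2 * I.r := by
    intro i
    obtain ⟨a, ha, h⟩ := hZ.exists_zone hrank i
    refine ⟨a, ha, fun v hv => ?_⟩
    have := h v v.2 hv
    rw [hb v v.2, hr] at this
    exact ⟨this.1, by linarith [this.2]⟩
  obtain ⟨𝒯, L, hsize, htree, hbag, hidx, hwit⟩ := I.exists_witness (N := n + n) (by omega)
    (fun v => s.natArr 0 v) (fun v => s.natArr 1 v) (fun v => s.natArr 2 v) hhi hlohi hangle hfar
    hzone
  exact ⟨𝒯, L, ⟨hsize.trans h1.symm, htree, hbag, hidx⟩, by omega, hwit⟩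

theorem mainTheorem4 :
    (∃ (P : RealRAM.Prog) (C : ℝ), ∀ (n : ℕ) (I : DiskInstance n), 0 < n →
      ∃ (t : ℕ) (s : RealRAM.State),
        I.Runs P t s ∧
        (t : ℝ) ≤ C * (n * Real.log (n + 1)) ∧
        ∃ (𝒯 : TreeDecomposition I.graph) (L : Layering I.graph),
          s.Represents 𝒯 L ∧ 𝒯.size ≤ 2 * n ∧ 𝒯.Witnesses L 30) ∧
    (∀ {V : Type*} [Finite V] (G : SimpleGraph V) (r : ℝ),
      IsSphericalUniformDiskGraph G r → layeredTreeIndependenceNumber G ≤ 30) := by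
  refine ⟨⟨RealRAM.decompositionProg, 684, fun n I hn => I.exists_runs hn⟩, fun {V} _ G r hG => ?_⟩
  rcases isEmpty_or_nonempty V with hV | hV
  · exact layeredTreeIndependenceNumber_of_isEmpty G
  · obtain ⟨I, ⟨e⟩⟩ := hG.exists_instance
    obtain ⟨-, -, -, -, 𝒯, L, -, -, hwit⟩ := I.exists_runs Nat.card_pos
    exact (hwit.comap e).layeredTreeIndependenceNumber_le
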